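/- Let $n\ge 2$. For $i\ge 1$ let $s_i$ be the permutation of the set of binary words $w_1\cdots w_n\in\{0,1\}^n$ that replaces $w_i$ by $w_i+1 \bmod 2$ if $i\le n$ and $w_1=\dots=w_{i-1}=0$, and leaves the word unchanged otherwise. Let $\Sigma_n=\langle s_1,\dots,s_n\rangle$, a Sylow $2$-subgroup of $\mathrm{Sym}(2^n)$. Write $[h,k]=h^{-1}k^{-1}hk$. For $i_1>\dots>i_m\ge 1$ let $[i_1,\dots,i_m]$ be the left-normed commutator $[[\dots[s_{i_1},s_{i_2}],\dots],s_{i_m}]$ (with $[i]=s_i$ and $[\ ]=1$); when $i_1\le n$ (or for $[\ ]$) it is called a rigid commutator of $\Sigma_n$. For $a\ge 1$ and $X\subseteq\{1,\dots,a-1\}$ let $[a;X]$ denote $[i_1,\dots,i_m]$, where $i_1>\dots>i_m$ are the elements of $\{1,\dots,a\}\setminus X$. Let $T=\langle [1;\emptyset],\dots,[n;\emptyset]\rangle$, $N_n^0=N_{\Sigma_n}(T)$ and $N_n^i=N_{\Sigma_n}(N_n^{i-1})$ for $i\ge 1$. For a finite set $X$ of positive integers let $\sum X$ be the sum of its elements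 and $\operatorname{mex}(X)$ the least positive integer not in $X$. A non-empty such $X$ is an unrefinable partition (of $\sum X$ into distinct parts) if there are no $x\in X$ and no finite set $Y$ of positive integers disjoint from $X$ with $x=\sum Y$. (i) Let $a>1$, $X\subseteq\{1,\dots,a-1\}$ and $k=\operatorname{mex}(X)$. Then $[a;X]\in N_n^{n-1}\setminus N_n^{n-2}$ if and only if (1) $\sum X=a+1$, (2) $X$ is an unrefinable partition, and (3) $a\le n<a+k$. (ii) Let $\mathcal P_n$ be the set of the unrefinable partitions $X$ of an integer $a+1$ into distinct parts, all less than $a$, with $a\le n<a+\operatorname{mex}(X)$. Then $X\mapsto c_X=[\sum X-1;\,X]$ is a bijection from $\mathcal P_n$ onto the set of rigid commutators of $\Sigma_n$ that lie in $N_n^{n-1}\setminus N_n^{n-2}$. (iii) For every ordering $X_1,\dots,X_r$ of $\mathcal P_n$, the $2^r$ products $c_{X_{j_1}}c_{X_{j_2}}\cdots c_{X_{j_l}}$, $1\le j_1<\dots<j_l\le r$, $0\le l\le r$, form a transversal of $N_n^{n-2}$ in $N_n^{n-1}$: each coset $gN_n^{n-2}$ with $g\in N_n^{n-1}$ contains exactly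 one of them, for exactly one choice of indices. -/

import Mathlib

/-- The generator `s_i` acting on the binary words `w₁ … w_n` of length `n` (the letter `w_j` is
stored at the index `j - 1`): the letter `w_i` is increased by `1` modulo `2` if
`w₁ = … = w_{i-1} = 0`, and all other letters are unchanged. A word whose length is less than `i`
is left unchanged. -/
def treeGenFun (n i : ℕ) (w : Fin n → ZMod 2) : Fin n → ZMod 2 := fun j =>
  if (j : ℕ) + 1 = i ∧ ∀ l : Fin n, l < j → w l = 0 then w j + 1 else w j

theorem treeGenFun_involutive (n i : ℕ) : Function.Involutive (treeGenFun n i) := by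
  intro w
  have h2 : (1 : ZMod 2) + 1 = 0 := by decide
  have key : ∀ l : Fin n, (l : ℕ) + 1 ≠ i → treeGenFun n i w l = w l := by
    intro l hl
    simp [treeGenFun, hl]
  funext j
  by_cases hj : (j : ℕ) + 1 = i
  · have hlt : ∀ l : Fin n, l < j → treeGenFun n i w l = w l := by
      intro l hl
      apply key
      have : (l : ℕ) < j := hl
      omega
    have hcond : (∀ l : Fin n, l < j → treeGenFun n i w l = 0) ↔ (∀ l : Fin n, l < j → w l = 0) :=
      ⟨fun h l hl => (hlt l hl) ▸ h l hl, fun h l hl => (hlt l hl).trans (h l hl)⟩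
    by_cases hc : ∀ l : Fin n, l < j → w l = 0
    · have h1 : treeGenFun n i w j = w j + 1 := by
        unfold treeGenFun; rw [if_pos ⟨hj, hc⟩]
      have hh : treeGenFun n i (treeGenFun n i w) j = treeGenFun n i w j + 1 := by
        conv_lhs => unfold treeGenFun
        exact if_pos ⟨hj, hcond.mpr hc⟩
      rw [hh, h1, add_assoc, h2, add_zero]
    · have h1 : treeGenFun n i w j = w j := by
        unfold treeGenFun; rw [if_neg (fun h => hc h.2)]
      have hh : treeGenFun n i (treeGenFun n i w) j = treeGenFun n i w j := by
        conv_lhs => unfold treeGenFun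
        exact if_neg (fun h => hc (hcond.mp h.2))
      rw [hh, h1]
  · have h1 : treeGenFun n i (treeGenFun n i w) j = treeGenFun n i w j := by
      conv_lhs => unfold treeGenFun
      exact if_neg (fun h => hj h.1)
    rw [h1, key j hj]

/-- The permutation `s_i` of the `2 ^ n` binary words of length `n`. -/
def treeGen (n i : ℕ) : Equiv.Perm (Fin n → ZMod 2) :=
  (treeGenFun_involutive n i).toPerm

/-- The Sylow `2`-subgroup `Σ_n = ⟨s_1, …, s_n⟩` of the symmetric group on the `2 ^ n` words. -/
def sylowTwo (n : ℕ) : Subgroup (Equiv.Perm (Fin n → ZMod 2)) :=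
  Subgroup.closure {g | ∃ i, 1 ≤ i ∧ i ≤ n ∧ g = treeGen n i}

/-- The commutator `[h, k] = h⁻¹ k⁻¹ h k`. -/
def groupComm {G : Type*} [Group G] (h k : G) : G := h⁻¹ * k⁻¹ * h * k

/-- The left-normed commutator `[[…[g₁, g₂], …], g_m]`; it is `g₁` for a list of length one and
the identity for the empty list. -/
def leftNormedComm {G : Type*} [Group G] : List G → G
  | [] => 1
  | g :: l => l.foldl groupComm g

/-- The rigid commutators `[s_{i₁}, …, s_{i_k}]`, `n ≥ i₁ > ⋯ > i_k ≥ 1`, of `Σ_n` (with `[ ] = 1`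
included). -/
def rigidCommutators (n : ℕ) : Set (Equiv.Perm (Fin n → ZMod 2)) :=
  {g | ∃ l : List ℕ, l.Pairwise (· > ·) ∧ (∀ i ∈ l, 1 ≤ i ∧ i ≤ n) ∧
    g = leftNormedComm (l.map (treeGen n))}

/-- The punctured notation: for `X ⊆ {1, …, a - 1}`, the commutator `[a; X]` is the left-normed
commutator of the `s_i`, `i ∈ {1, …, a} \ X`, taken in decreasing order of `i`. -/
def punctured (n a : ℕ) (X : Finset ℕ) : Equiv.Perm (Fin n → ZMod 2) :=
  leftNormedComm (((Finset.Icc 1 a \ X).sort (· ≥ ·)).map (treeGen n))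

/-- The elementary abelian regular subgroup `T = ⟨t_1, …, t_n⟩`, where
`t_i = [s_i, s_{i-1}, …, s_1]`. -/
def translationSubgroup (n : ℕ) : Subgroup (Equiv.Perm (Fin n → ZMod 2)) :=
  Subgroup.closure {g | ∃ i, 1 ≤ i ∧ i ≤ n ∧ g = punctured n i ∅}

/-- The normalizer chain: `N_n^0` is the normalizer of `T` in `Σ_n`, and `N_n^{i+1}` is the
normalizer of `N_n^i` in `Σ_n`. -/
def normalizerChain (n : ℕ) : ℕ → Subgroup (Equiv.Perm (Fin n → ZMod 2))
  | 0 => Subgroup.normalizer (translationSubgroup n : Set (Equiv.Perm (Fin n → ZMod 2))) ⊓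
      sylowTwo n
  | i + 1 => Subgroup.normalizer (normalizerChain n i : Set (Equiv.Perm (Fin n → ZMod 2))) ⊓
      sylowTwo n

/-- A finite non-empty set of positive integers is refinable if one of its elements is the sum of a
set of positive integers that avoids it. -/
def IsRefinable (X : Finset ℕ) : Prop :=
  ∃ x ∈ X, ∃ Y : Finset ℕ, 0 ∉ Y ∧ Disjoint Y X ∧ x = ∑ y ∈ Y, y

/-- `X` is an unrefinable partition (of `∑ X`) into distinct parts. -/
def IsUnrefinablePartition (X : Finset ℕ) : Prop :=
  X.Nonempty ∧ 0 ∉ X ∧ ¬ IsRefinable X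

/-- The minimal excludant: the least positive integer that is not in `X`. -/
noncomputable def minExcludant (X : Finset ℕ) : ℕ := sInf {k | 0 < k ∧ k ∉ X}

/-- The unrefinable partitions `X` of an integer `a + 1` into distinct parts, all less than `a`,
such that `a ≤ n < a + mex X`. -/
def mexPartitions (n : ℕ) : Set (Finset ℕ) :=
  {X | IsUnrefinablePartition X ∧ ∃ a, ∑ x ∈ X, x = a + 1 ∧ (∀ x ∈ X, x < a) ∧
    a ≤ n ∧ n < a + minExcludant X}

/-! Over the field with two elements every function of a word is a unique combination of the
square-free monomials `mono X`. An element of `Σ_n` moves a letter by a function of the earlier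
letters, and the rigid commutator `[a; X]` adds one monomial, that of `X`, to the letter `w_a`.
Commutation thereby becomes combinatorial: by `groupComm_rigid` it replaces a letter `b` of `X` by a
set `Y`.

A system of monomials that contains the empty sets and is closed under this rule spans a group, and
the normalizer of this group in `Σ_n` is again spanned by monomials, those whose commutators with
the system stay inside it (`Saturated.mem_normalizer_iff`). The chain is thus computed on finite
sets. With sets weighed by the sum of their letters, counted from one, a replacement gives weight at
most `∑ X + ∑ Y - b`. Up to `N_n^{n-2}` each step raises the admissible weight by one
(`normalizing_level`), ending at `∑ X ≤ a`. The next step admits the weight `a + 1` only if no part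
can be replaced by a disjoint set of the same sum (unrefinability) and there is no letter `a + k ≤
n`, `k = mex X`, in which the monomial `{a, k}` would make the commutator too heavy
(`mem_normalizing_last`).

Commutators of the rigid elements of `N_n^{n-1}` fall into `N_n^{n-2}` (`comm_normalizing_last`), so
the coefficients of the new monomials are homomorphisms to `ZMod 2` with common kernel `N_n^{n-2}`
in `N_n^{n-1}`. The `c_X` are dual to them, and the products in any fixed order form a transversal.
-/

namespace BinaryTree

/-! ### Square-free monomials, derivatives and coefficients over `ZMod 2`. -/

section Functions

variable {ι : Type*}

/-- The monomial `∏_{i ∈ X} (w_i + 1)` as a function of the word `w`. -/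
def mono (X : Finset ι) (w : ι → ZMod 2) : ZMod 2 := by
  classical exact if ∀ i ∈ X, w i = 0 then 1 else 0

theorem mono_eq_one {X : Finset ι} {w : ι → ZMod 2} (h : ∀ i ∈ X, w i = 0) : mono X w = 1 := by
  simp only [mono]; rw [if_pos h]

theorem mono_eq_zero {X : Finset ι} {w : ι → ZMod 2} (h : ¬ ∀ i ∈ X, w i = 0) : mono X w = 0 := by
  simp only [mono]; rw [if_neg h]

theorem zmod_two_cases (c : ZMod 2) : c = 0 ∨ c = 1 := by
  revert c; decide

theorem zmod_two_add_self (c : ZMod 2) : c + c = 0 := by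
  revert c; decide

theorem fun_add_self {α : Type*} (p : α → ZMod 2) : p + p = 0 :=
  funext fun w => zmod_two_add_self (p w)

theorem fun_add_eq_zero {α : Type*} {p q : α → ZMod 2} (h : p + q = 0) : p = q := by
  have h1 : p + (q + q) = q := by rw [← add_assoc, h, zero_add]
  rwa [fun_add_self, add_zero] at h1

/-- The span of the monomials with index in `D`. -/
def mspan (D : Set (Finset ι)) : Submodule (ZMod 2) ((ι → ZMod 2) → ZMod 2) :=
  Submodule.span (ZMod 2) (mono '' D)

theorem mono_mem_mspan {D : Set (Finset ι)} {X : Finset ι} (h : X ∈ D) : mono X ∈ mspan D :=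
  Submodule.subset_span ⟨X, h, rfl⟩

theorem mspan_mono {D E : Set (Finset ι)} (h : D ⊆ E) : mspan D ≤ mspan E :=
  Submodule.span_mono (Set.image_mono h)

theorem mspan_induction {D : Set (Finset ι)} {P : ((ι → ZMod 2) → ZMod 2) → Prop}
    (h0 : P 0) (hadd : ∀ p q, P p → P q → P (p + q)) (hm : ∀ X ∈ D, P (mono X))
    {p : (ι → ZMod 2) → ZMod 2} (hp : p ∈ mspan D) : P p := by
  refine Submodule.span_induction (p := fun p _ => P p) ?_ h0 (fun p q _ _ => hadd p q) ?_ hp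
  · rintro _ ⟨X, hX, rfl⟩
    exact hm X hX
  · intro c p _ h
    rcases zmod_two_cases c with rfl | rfl
    · simpa using h0
    · simpa using h

theorem mono_empty : mono (∅ : Finset ι) = 1 := funext fun w => mono_eq_one (by simp)

theorem mono_singleton (k : ι) (w : ι → ZMod 2) : mono {k} w = w k + 1 := by
  rcases zmod_two_cases (w k) with h | h
  · rw [mono_eq_one (by simpa using h), h, zero_add]
  · rw [mono_eq_zero (by simp [h]), h]; rfl

variable [DecidableEq ι]

theorem mono_mul (X Y : Finset ι) : mono X * mono Y = mono (X ∪ Y) := by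
  funext w
  by_cases hX : ∀ i ∈ X, w i = 0
  · by_cases hY : ∀ i ∈ Y, w i = 0
    · rw [Pi.mul_apply, mono_eq_one hX, mono_eq_one hY, mono_eq_one, one_mul]
      intro i hi
      rcases Finset.mem_union.1 hi with h | h
      exacts [hX i h, hY i h]
    · rw [Pi.mul_apply, mono_eq_zero hY, mono_eq_zero (X := X ∪ Y), mul_zero]
      exact fun h : ∀ i ∈ X ∪ Y, w i = 0 => hY fun i hi => h i (Finset.mem_union_right _ hi)
  · rw [Pi.mul_apply, mono_eq_zero hX, mono_eq_zero (X := X ∪ Y), zero_mul]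
    exact fun h : ∀ i ∈ X ∪ Y, w i = 0 => hX fun i hi => h i (Finset.mem_union_left _ hi)

theorem mono_insert (k : ι) (X : Finset ι) : mono (insert k X) = mono {k} * mono X := by
  rw [mono_mul, Finset.insert_eq]

theorem mul_mem_mspan {A B C : Set (Finset ι)} {p q : (ι → ZMod 2) → ZMod 2}
    (h : ∀ X ∈ A, ∀ Y ∈ B, X ∪ Y ∈ C) (hp : p ∈ mspan A) (hq : q ∈ mspan B) :
    p * q ∈ mspan C := by
  refine mspan_induction (P := fun p => p * q ∈ mspan C) ?_ ?_ ?_ hp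
  · simp
  · intro p p' h1 h2
    rw [add_mul]; exact add_mem h1 h2
  · intro X hX
    refine mspan_induction (P := fun q => mono X * q ∈ mspan C) ?_ ?_ ?_ hq
    · simp
    · intro p p' h1 h2
      rw [mul_add]; exact add_mem h1 h2
    · intro Y hY
      rw [mono_mul]; exact mono_mem_mspan (h X hX Y hY)

/-- The function `p` does not depend on the letter `w_k`. -/
def Free (k : ι) (p : (ι → ZMod 2) → ZMod 2) : Prop :=
  ∀ w c, p (Function.update w k c) = p w

theorem Free.zero (k : ι) : Free k (0 : (ι → ZMod 2) → ZMod 2) := fun _ _ => rfl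

theorem Free.add {k : ι} {p q : (ι → ZMod 2) → ZMod 2} (hp : Free k p) (hq : Free k q) :
    Free k (p + q) := fun w c => by
  rw [Pi.add_apply, hp, hq, Pi.add_apply]

theorem Free.mono {k : ι} {X : Finset ι} (h : k ∉ X) : Free k (mono X) := by
  intro w c
  have : (∀ i ∈ X, Function.update w k c i = 0) ↔ ∀ i ∈ X, w i = 0 := by
    refine forall₂_congr fun i hi => ?_
    rw [Function.update_of_ne (ne_of_mem_of_not_mem hi h)]
  simp only [BinaryTree.mono]
  congr 1
  exact propext this

theorem Free.of_mem_mspan {k : ι} {D : Set (Finset ι)} (h : ∀ X ∈ D, k ∉ X)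
    {p : (ι → ZMod 2) → ZMod 2} (hp : p ∈ mspan D) : Free k p := by
  refine mspan_induction (P := Free k) ?_ ?_ (fun X hX => Free.mono (h X hX)) hp
  · exact Free.zero k
  · exact fun p q => Free.add

theorem Free.mul {k : ι} {p q : (ι → ZMod 2) → ZMod 2} (hp : Free k p) (hq : Free k q) :
    Free k (p * q) := fun w c => by
  rw [Pi.mul_apply, hp, hq, Pi.mul_apply]

/-- The specialization of `p` at `w_k = c`. -/
def special (k : ι) (c : ZMod 2) : ((ι → ZMod 2) → ZMod 2) →ₗ[ZMod 2] ((ι → ZMod 2) → ZMod 2) where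
  toFun p w := p (Function.update w k c)
  map_add' _ _ := rfl
  map_smul' _ _ := rfl

/-- The partial derivative of `p` with respect to the letter `w_k`. -/
def pderiv (k : ι) : ((ι → ZMod 2) → ZMod 2) →ₗ[ZMod 2] ((ι → ZMod 2) → ZMod 2) :=
  special k 0 + special k 1

theorem pderiv_apply (k : ι) (p : (ι → ZMod 2) → ZMod 2) (w : ι → ZMod 2) :
    pderiv k p w = p (Function.update w k 0) + p (Function.update w k 1) := rfl

theorem pderiv_of_free {k : ι} {p : (ι → ZMod 2) → ZMod 2} (h : Free k p) : pderiv k p = 0 := by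
  funext w
  rw [pderiv_apply, h, h, zmod_two_add_self]; rfl

theorem special_of_free {k : ι} {c : ZMod 2} {p : (ι → ZMod 2) → ZMod 2} (h : Free k p) :
    special k c p = p := funext fun w => h w c

theorem pderiv_var_mul {k : ι} {p : (ι → ZMod 2) → ZMod 2} (h : Free k p) :
    pderiv k (mono {k} * p) = p := by
  funext w
  rw [pderiv_apply, Pi.mul_apply, Pi.mul_apply, h, h, mono_singleton, mono_singleton]
  simp only [Function.update_self]
  have : (1 : ZMod 2) + 1 = 0 := by decide
  rw [this]; ring

theorem special_var_mul (k : ι) (p : (ι → ZMod 2) → ZMod 2) :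
    special k 1 (mono {k} * p) = 0 := by
  funext w
  have h1 : (1 : ZMod 2) + 1 = 0 := by decide
  have : special k 1 (mono {k} * p) w
      = mono {k} (Function.update w k 1) * p (Function.update w k 1) := rfl
  rw [this, mono_singleton, Function.update_self, h1, zero_mul]; rfl

theorem pderiv_mono_of_mem {k : ι} {X : Finset ι} (h : k ∈ X) :
    pderiv k (mono X) = mono (X.erase k) := by
  conv_lhs => rw [← Finset.insert_erase h, mono_insert]
  exact pderiv_var_mul (Free.mono (Finset.notMem_erase _ _))

theorem pderiv_mem_mspan {k : ι} {D : Set (Finset ι)} {p : (ι → ZMod 2) → ZMod 2}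
    (hp : p ∈ mspan D) : pderiv k p ∈ mspan {Z | k ∉ Z ∧ insert k Z ∈ D} := by
  refine mspan_induction (P := fun p => pderiv k p ∈ mspan {Z | k ∉ Z ∧ insert k Z ∈ D})
    ?_ ?_ ?_ hp
  · simp
  · intro p q h1 h2
    rw [map_add]; exact add_mem h1 h2
  · intro X hX
    by_cases h : k ∈ X
    · rw [pderiv_mono_of_mem h]
      refine mono_mem_mspan ⟨Finset.notMem_erase _ _, ?_⟩
      rwa [Finset.insert_erase h]
    · rw [pderiv_of_free (Free.mono h)]; exact zero_mem _

theorem special_mem_mspan {k : ι} {D : Set (Finset ι)} {p : (ι → ZMod 2) → ZMod 2}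
    (hp : p ∈ mspan D) : special k 1 p ∈ mspan D := by
  refine mspan_induction (P := fun p => special k 1 p ∈ mspan D) ?_ ?_ ?_ hp
  · simp
  · intro p q h1 h2
    rw [map_add]; exact add_mem h1 h2
  · intro X hX
    by_cases h : k ∈ X
    · rw [← Finset.insert_erase h, mono_insert, special_var_mul]
      exact zero_mem _
    · rw [special_of_free (Free.mono h)]; exact mono_mem_mspan hX

/-- A function of one letter in `ZMod 2` is affine, so the first-order Taylor formula is exact. -/
theorem apply_update_add (p : (ι → ZMod 2) → ZMod 2) (k : ι) (w : ι → ZMod 2) (c : ZMod 2) :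
    p (Function.update w k (w k + c)) = p w + c * pderiv k p w := by
  have h11 : (1 : ZMod 2) + 1 = 0 := by decide
  rw [pderiv_apply]
  rcases zmod_two_cases c with rfl | rfl
  · simp
  · rcases zmod_two_cases (w k) with h | h
    · have : Function.update w k 0 = w := by rw [← h, Function.update_eq_self]
      rw [this, h, zero_add, one_mul, ← add_assoc, zmod_two_add_self, zero_add]
    · have : Function.update w k 1 = w := by rw [← h, Function.update_eq_self]
      rw [this, h, h11, one_mul, add_left_comm, zmod_two_add_self, add_zero]

/-- The word with `w_i = 0` exactly for `i ∈ Z`. -/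
def point (Z : Finset ι) : ι → ZMod 2 := fun i => if i ∈ Z then 0 else 1

/-- The coefficient of the monomial `mono X` in `p`. -/
def coeff (X : Finset ι) : ((ι → ZMod 2) → ZMod 2) →ₗ[ZMod 2] ZMod 2 where
  toFun p := ∑ Z ∈ X.powerset, p (point Z)
  map_add' p q := Finset.sum_add_distrib
  map_smul' c p := by
    simp [Finset.mul_sum]

theorem coeff_apply (X : Finset ι) (p : (ι → ZMod 2) → ZMod 2) :
    coeff X p = ∑ Z ∈ X.powerset, p (point Z) := rfl

theorem point_insert (k : ι) (Z : Finset ι) : point (insert k Z) = Function.update (point Z) k 0 := by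
  funext i
  by_cases h : i = k
  · subst h; simp [point]
  · simp [point, h]

theorem point_eq_update {k : ι} {Z : Finset ι} (h : k ∉ Z) :
    point Z = Function.update (point Z) k 1 := by
  funext i
  by_cases h' : i = k
  · subst h'; simp [point, h]
  · simp [h']

theorem pderiv_point {k : ι} {Z : Finset ι} (h : k ∉ Z) (p : (ι → ZMod 2) → ZMod 2) :
    pderiv k p (point Z) = p (point Z) + p (point (insert k Z)) := by
  rw [pderiv_apply, ← point_insert, ← point_eq_update h, add_comm]

/-- The subsets of `insert k X` pair off as `Z` and `insert k Z`, and each pair contributes a value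
of the derivative. -/
theorem coeff_insert {k : ι} {X : Finset ι} (h : k ∉ X) (p : (ι → ZMod 2) → ZMod 2) :
    coeff (insert k X) p = coeff X (pderiv k p) := by
  rw [coeff_apply, coeff_apply, Finset.sum_powerset_insert h, ← Finset.sum_add_distrib]
  refine Finset.sum_congr rfl fun Z hZ => ?_
  rw [pderiv_point fun hk => h (Finset.mem_powerset.1 hZ hk)]

theorem coeff_mono (X Y : Finset ι) : coeff X (mono Y) = if X = Y then 1 else 0 := by
  induction X using Finset.induction_on generalizing Y with
  | empty =>
    rw [coeff_apply, Finset.powerset_empty, Finset.sum_singleton]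
    by_cases h : Y = ∅
    · subst h; rw [if_pos rfl, mono_empty]; rfl
    · rw [if_neg (Ne.symm h), mono_eq_zero]
      obtain ⟨y, hy⟩ := Finset.nonempty_iff_ne_empty.2 h
      intro h'
      simpa [point] using h' y hy
  | insert k X hk ih =>
    rw [coeff_insert hk]
    by_cases h : k ∈ Y
    · rw [pderiv_mono_of_mem h, ih]
      congr 1
      refine propext ⟨fun e => by rw [e, Finset.insert_erase h], fun e => ?_⟩
      rw [← e, Finset.erase_insert hk]
    · rw [pderiv_of_free (Free.mono h), map_zero, if_neg]
      rintro rfl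
      exact h (Finset.mem_insert_self _ _)

theorem mem_of_coeff_ne_zero {D : Set (Finset ι)} {p : (ι → ZMod 2) → ZMod 2} (hp : p ∈ mspan D)
    {X : Finset ι} (hX : coeff X p ≠ 0) : X ∈ D := by
  by_contra h
  refine hX (mspan_induction (P := fun p => coeff X p = 0) (map_zero _) ?_ ?_ hp)
  · intro p q h1 h2
    rw [map_add, h1, h2, add_zero]
  · intro Y hY
    rw [coeff_mono, if_neg]
    rintro rfl
    exact h hY

theorem mono_mem_mspan_iff {D : Set (Finset ι)} {X : Finset ι} : mono X ∈ mspan D ↔ X ∈ D :=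
  ⟨fun h => mem_of_coeff_ne_zero h (by rw [coeff_mono, if_pos rfl]; exact one_ne_zero),
    mono_mem_mspan⟩

variable [Fintype ι]

/-- Möbius inversion: the value at `point Z` is determined by the coefficient at `Z` and the values
at proper subsets. -/
theorem eq_zero_of_coeff_eq_zero {p : (ι → ZMod 2) → ZMod 2} (h : ∀ X, coeff X p = 0) : p = 0 := by
  have key : ∀ Z : Finset ι, p (point Z) = 0 := by
    intro Z
    induction Z using Finset.strongInduction with
    | H Z ih =>
      have h1 := h Z
      rw [coeff_apply, ← Finset.insert_erase (Finset.mem_powerset_self Z),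
        Finset.sum_insert (Finset.notMem_erase _ _), Finset.sum_eq_zero, add_zero] at h1
      · exact h1
      · intro Y hY
        rw [Finset.mem_erase, Finset.mem_powerset] at hY
        exact ih Y (hY.2.ssubset_of_ne hY.1)
  funext w
  have : w = point (Finset.univ.filter fun i => w i = 0) := by
    funext i
    rcases zmod_two_cases (w i) with h | h <;> simp [point, h]
  rw [this, key]; rfl

theorem eq_sum_mono (p : (ι → ZMod 2) → ZMod 2) :
    p = ∑ X ∈ Finset.univ.filter (fun X => coeff X p ≠ 0), mono X := by
  refine fun_add_eq_zero (eq_zero_of_coeff_eq_zero fun Y => ?_)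
  rw [map_add, map_sum, Finset.sum_congr rfl fun X _ => coeff_mono Y X, Finset.sum_ite_eq]
  rcases zmod_two_cases (coeff Y p) with h | h
  · simp [h]
  · simp [h, zmod_two_add_self]

theorem mem_mspan_iff {D : Set (Finset ι)} {p : (ι → ZMod 2) → ZMod 2} :
    p ∈ mspan D ↔ ∀ X, coeff X p ≠ 0 → X ∈ D := by
  refine ⟨fun h X => mem_of_coeff_ne_zero h, fun h => ?_⟩
  rw [eq_sum_mono p]
  exact sum_mem fun X hX => mono_mem_mspan (h X (Finset.mem_filter.1 hX).2)

/-- Multiplying `f` by all the monomials of a simplicial complex does not hide a monomial of `f`. -/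
theorem union_mem_of_mul_mem {D U : Set (Finset ι)} (hD : ∀ Z ∈ D, ∀ Y, Y ⊆ Z → Y ∈ D)
    {f : (ι → ZMod 2) → ZMod 2} (hf : ∀ Z ∈ D, f * mono Z ∈ mspan U) {X Z : Finset ι}
    (hX : coeff X f ≠ 0) (hZ : Z ∈ D) : X ∪ Z ∈ U := by
  classical
  by_contra hbad
  -- A bad monomial of maximal size is multiplied by `Z \ X` instead of `Z`. Any other monomial of
  -- `f` with the same product would contain `X` strictly and be bad too, so nothing cancels.
  obtain ⟨X, hXm, hmax⟩ := Finset.exists_max_image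
    (Finset.univ.filter fun X => coeff X f ≠ 0 ∧ ∃ Z ∈ D, X ∪ Z ∉ U) Finset.card
    ⟨X, Finset.mem_filter.2 ⟨Finset.mem_univ _, hX, Z, hZ, hbad⟩⟩
  clear hX hbad hZ Z
  obtain ⟨-, hX, Z, hZ, hbad⟩ := Finset.mem_filter.1 hXm
  have hmem := hf (Z \ X) (hD Z hZ _ Finset.sdiff_subset)
  have hne : coeff (X ∪ Z) (f * mono (Z \ X)) ≠ 0 := by
    conv_lhs => rw [eq_sum_mono f, Finset.sum_mul]
    rw [Finset.sum_congr rfl fun Y _ => mono_mul Y (Z \ X), map_sum,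
      Finset.sum_congr rfl fun Y _ => coeff_mono (X ∪ Z) (Y ∪ (Z \ X)),
      Finset.sum_eq_single X]
    · rw [if_pos (by simp)]; exact one_ne_zero
    · intro Y hY hne
      rw [if_neg]
      intro e
      have hsub : X ⊆ Y := by
        intro i hi
        have : i ∈ Y ∪ (Z \ X) := e ▸ Finset.mem_union_left _ hi
        simpa [hi] using this
      have hlt := Finset.card_lt_card (hsub.ssubset_of_ne (Ne.symm hne))
      refine absurd (hmax Y ?_) (not_le.2 hlt)
      refine Finset.mem_filter.2 ⟨Finset.mem_univ _, (Finset.mem_filter.1 hY).2, Z \ X,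
        hD Z hZ _ Finset.sdiff_subset, ?_⟩
      rwa [← e]
    · exact fun h => absurd (Finset.mem_filter.2 ⟨Finset.mem_univ X, hX⟩) h
  exact hbad (mem_of_coeff_ne_zero hmem hne)

end Functions

/-! ### Triangular permutations and the groups spanned by saturated systems. -/

section Groups

variable {ι : Type*} [LinearOrder ι]

section Substitution

variable {h : (ι → ZMod 2) → (ι → ZMod 2)} {R : ι → Set (Finset ι)} {D D' : Set (Finset ι)}

/-- Letters are substituted from the smallest up, so that the new letters from `R b` never await
substitution themselves. `V` stands for the larger letters not yet treated; quantifying over it lets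
the induction move `b` from `V` into `U`. In the difference at least one letter is replaced, and the
last replacement is the one that lands in `D'`. -/
theorem mono_comp_mem (hR : ∀ b, (fun w => h w b + w b) ∈ mspan (R b))
    (hlt : ∀ b, ∀ Y ∈ R b, ∀ y ∈ Y, y < b)
    (hD : ∀ X ∈ D, ∀ b ∈ X, ∀ Y ∈ R b, X.erase b ∪ Y ∈ D)
    (hD' : ∀ X ∈ D, ∀ b ∈ X, ∀ Y ∈ R b, X.erase b ∪ Y ∈ D') (U : Finset ι) :
    mono U ∘ h ∈ mspan {Z | (∀ z ∈ Z, ∃ u ∈ U, z ≤ u) ∧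
        ∀ V, (∀ v ∈ V, ∀ u ∈ U, u < v) → U ∪ V ∈ D → Z ∪ V ∈ D} ∧
      mono U ∘ h + mono U ∈ mspan {Z | (∀ z ∈ Z, ∃ u ∈ U, z ≤ u) ∧
        ∀ V, (∀ v ∈ V, ∀ u ∈ U, u < v) → U ∪ V ∈ D → Z ∪ V ∈ D'} := by
  induction U using Finset.induction_on_max with
  | empty =>
    have : mono (∅ : Finset ι) ∘ h = mono ∅ := by rw [mono_empty]; rfl
    rw [this, fun_add_self]
    exact ⟨mono_mem_mspan ⟨by simp, fun V _ hV => hV⟩, zero_mem _⟩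
  | insert b U hb ih =>
    obtain ⟨ih1, ih2⟩ := ih
    have hvar : ∀ E : Set (Finset ι), ∀ X ∈ ({{b}} : Set (Finset ι)), ∀ Z ∈ {Z | (∀ z ∈ Z, ∃ u ∈ U, z ≤ u) ∧
        ∀ V, (∀ v ∈ V, ∀ u ∈ U, u < v) → U ∪ V ∈ D → Z ∪ V ∈ E}, X ∪ Z ∈
        {Z | (∀ z ∈ Z, ∃ u ∈ insert b U, z ≤ u) ∧
        ∀ V, (∀ v ∈ V, ∀ u ∈ insert b U, u < v) → insert b U ∪ V ∈ D → Z ∪ V ∈ E} := by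
      rintro E _ rfl Z ⟨hZ, hZV⟩
      refine ⟨fun z hz => ?_, fun V hV hUV => ?_⟩
      · rcases Finset.mem_union.1 hz with hz | hz
        · exact ⟨b, Finset.mem_insert_self _ _, (Finset.mem_singleton.1 hz).le⟩
        · obtain ⟨u, hu, hzu⟩ := hZ z hz
          exact ⟨u, Finset.mem_insert_of_mem hu, hzu⟩
      · have := hZV (insert b V) (fun v hv u hu => ?_) (by
          rwa [Finset.union_insert, ← Finset.insert_union])
        · rwa [Finset.union_insert, ← Finset.insert_union, Finset.insert_eq] at this
        · rcases Finset.mem_insert.1 hv with rfl | hv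
          · exact hb u hu
          · exact hV v hv u (Finset.mem_insert_of_mem hu)
    have hsub : ∀ E : Set (Finset ι), (∀ X ∈ D, ∀ b ∈ X, ∀ Y ∈ R b, X.erase b ∪ Y ∈ E) →
        ∀ Y ∈ R b, ∀ Z ∈ {Z | (∀ z ∈ Z, ∃ u ∈ U, z ≤ u) ∧
        ∀ V, (∀ v ∈ V, ∀ u ∈ U, u < v) → U ∪ V ∈ D → Z ∪ V ∈ D}, Y ∪ Z ∈
        {Z | (∀ z ∈ Z, ∃ u ∈ insert b U, z ≤ u) ∧
        ∀ V, (∀ v ∈ V, ∀ u ∈ insert b U, u < v) → insert b U ∪ V ∈ D → Z ∪ V ∈ E} := by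
      rintro E hE Y hY Z ⟨hZ, hZV⟩
      have hbZ : b ∉ Z := fun hbZ => by
        obtain ⟨u, hu, hbu⟩ := hZ b hbZ
        exact absurd (hb u hu) (not_lt.2 hbu)
      refine ⟨fun z hz => ?_, fun V hV hUV => ?_⟩
      · rcases Finset.mem_union.1 hz with hz | hz
        · exact ⟨b, Finset.mem_insert_self _ _, (hlt b Y hY z hz).le⟩
        · obtain ⟨u, hu, hzu⟩ := hZ z hz
          exact ⟨u, Finset.mem_insert_of_mem hu, hzu⟩
      · have hbV : b ∉ V := fun hbV => lt_irrefl _ (hV b hbV b (Finset.mem_insert_self _ _))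
        have := hZV (insert b V) (fun v hv u hu => ?_) (by
          rwa [Finset.union_insert, ← Finset.insert_union])
        · have := hE _ this b (by simp) Y hY
          rw [Finset.union_insert, Finset.erase_insert (by simp [hbZ, hbV])] at this
          rwa [Finset.union_comm Y Z, Finset.union_assoc, Finset.union_comm Y V,
            ← Finset.union_assoc]
        · rcases Finset.mem_insert.1 hv with rfl | hv
          · exact hb u hu
          · exact hV v hv u (Finset.mem_insert_of_mem hu)
    have hvarmem : mono {b} ∈ mspan ({{b}} : Set (Finset ι)) := mono_mem_mspan rfl
    have hcomp : mono (insert b U) ∘ h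
        = mono {b} * (mono U ∘ h) + (fun w => h w b + w b) * (mono U ∘ h) := by
      funext w
      have : (mono (insert b U) ∘ h) w = mono {b} (h w) * mono U (h w) := by
        rw [mono_insert]; rfl
      rw [this, Pi.add_apply, Pi.mul_apply, Pi.mul_apply, mono_singleton, mono_singleton]
      have h1 := zmod_two_add_self (w b)
      simp only [Function.comp]
      linear_combination (-mono U (h w)) * h1
    constructor
    · rw [hcomp]
      exact add_mem (mul_mem_mspan (hvar D) hvarmem ih1) (mul_mem_mspan (hsub D hD) (hR b) ih1)
    · have : mono (insert b U) ∘ h + mono (insert b U)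
          = mono {b} * (mono U ∘ h + mono U) + (fun w => h w b + w b) * (mono U ∘ h) := by
        rw [hcomp, mono_insert]; ring
      rw [this]
      exact add_mem (mul_mem_mspan (hvar D') hvarmem ih2) (mul_mem_mspan (hsub D' hD') (hR b) ih1)

theorem comp_add_mem_mspan (hR : ∀ b, (fun w => h w b + w b) ∈ mspan (R b))
    (hlt : ∀ b, ∀ Y ∈ R b, ∀ y ∈ Y, y < b)
    (hD : ∀ X ∈ D, ∀ b ∈ X, ∀ Y ∈ R b, X.erase b ∪ Y ∈ D)
    (hD' : ∀ X ∈ D, ∀ b ∈ X, ∀ Y ∈ R b, X.erase b ∪ Y ∈ D')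
    {p : (ι → ZMod 2) → ZMod 2} (hp : p ∈ mspan D) : p ∘ h + p ∈ mspan D' := by
  refine mspan_induction (P := fun p => p ∘ h + p ∈ mspan D') ?_ ?_ ?_ hp
  · have : (0 : (ι → ZMod 2) → ZMod 2) ∘ h + 0 = 0 := by rw [add_zero]; rfl
    rw [this]; exact zero_mem _
  · intro p q h1 h2
    have : (p + q) ∘ h + (p + q) = (p ∘ h + p) + (q ∘ h + q) := by
      rw [add_add_add_comm]; rfl
    rw [this]; exact add_mem h1 h2
  · intro X hX
    refine mspan_mono ?_ (mono_comp_mem hR hlt hD hD' X).2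
    rintro Z ⟨-, hZ⟩
    simpa using hZ ∅ (by simp) (by simpa using hX)

theorem comp_mem_mspan (hR : ∀ b, (fun w => h w b + w b) ∈ mspan (R b))
    (hlt : ∀ b, ∀ Y ∈ R b, ∀ y ∈ Y, y < b)
    (hD : ∀ X ∈ D, ∀ b ∈ X, ∀ Y ∈ R b, X.erase b ∪ Y ∈ D)
    {p : (ι → ZMod 2) → ZMod 2} (hp : p ∈ mspan D) : p ∘ h ∈ mspan D := by
  have h1 := add_mem (comp_add_mem_mspan hR hlt hD hD hp) hp
  rwa [add_assoc, fun_add_self, add_zero] at h1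

end Substitution

/-- The displacement of the letter `w_a` under `g`. -/
def disp (g : Equiv.Perm (ι → ZMod 2)) (a : ι) (w : ι → ZMod 2) : ZMod 2 := g w a + w a

omit [LinearOrder ι] in
theorem apply_eq_disp_add (g : Equiv.Perm (ι → ZMod 2)) (a : ι) (w : ι → ZMod 2) :
    g w a = disp g a w + w a := by
  rw [disp, add_assoc, zmod_two_add_self, add_zero]

omit [LinearOrder ι] in
theorem disp_one (a : ι) : disp (1 : Equiv.Perm (ι → ZMod 2)) a = 0 :=
  funext fun w => zmod_two_add_self (w a)

omit [LinearOrder ι] in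
theorem disp_mul (g h : Equiv.Perm (ι → ZMod 2)) (a : ι) :
    disp (g * h) a = disp g a ∘ h + disp h a := by
  funext w
  have := zmod_two_add_self (h w a)
  simp only [disp, Function.comp, Pi.add_apply, Equiv.Perm.mul_apply]
  linear_combination (-1 : ZMod 2) * this

/-- The permutations whose displacement at each letter `a` is a combination of monomials
from `S a`. -/
def tableaux (S : ι → Set (Finset ι)) : Set (Equiv.Perm (ι → ZMod 2)) :=
  {g | ∀ a, disp g a ∈ mspan (S a)}

omit [LinearOrder ι] in
theorem tableaux_mono {S S' : ι → Set (Finset ι)} (h : ∀ a, S a ⊆ S' a) :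
    tableaux S ⊆ tableaux S' := fun _ hg a => mspan_mono (h a) (hg a)

/-- A system of rigid commutators that contains the translations and is closed under commutators;
`X ∈ S a` stands for the rigid commutator that adds `mono X` to the letter `w_a`. -/
structure Saturated (S : ι → Set (Finset ι)) : Prop where
  lt : ∀ a, ∀ X ∈ S a, ∀ x ∈ X, x < a
  empty_mem : ∀ a, ∅ ∈ S a
  comm_mem : ∀ a, ∀ X ∈ S a, ∀ b ∈ X, ∀ Y ∈ S b, X.erase b ∪ Y ∈ S a

namespace Saturated

variable {S : ι → Set (Finset ι)}

theorem erase_mem (hS : Saturated S) {a : ι} {X : Finset ι} (hX : X ∈ S a) (b : ι) :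
    X.erase b ∈ S a := by
  by_cases hb : b ∈ X
  · simpa using hS.comm_mem a X hX b hb ∅ (hS.empty_mem b)
  · rwa [Finset.erase_eq_of_notMem hb]

/-- A commutator with a translation deletes a letter, so each `S a` is a simplicial complex. -/
theorem subset_mem (hS : Saturated S) {a : ι} {X Y : Finset ι} (hX : X ∈ S a) (hY : Y ⊆ X) :
    Y ∈ S a := by
  have key : ∀ Z : Finset ι, X \ Z ∈ S a := by
    intro Z
    induction Z using Finset.induction_on with
    | empty => simpa using hX
    | insert z Z _ ih =>
      rw [Finset.sdiff_insert]
      exact hS.erase_mem ih z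
  have := key (X \ Y)
  rwa [Finset.sdiff_sdiff_eq_self hY] at this

end Saturated

section Shear

omit [LinearOrder ι] in
-- The inverse of `g` is a power of `g`, so a subspace stable under `g` is stable under `g⁻¹`.
theorem mem_of_comp_mem [Finite ι] {V : Submodule (ZMod 2) ((ι → ZMod 2) → ZMod 2)}
    {g : Equiv.Perm (ι → ZMod 2)} (hV : ∀ p ∈ V, p ∘ g ∈ V) {p : (ι → ZMod 2) → ZMod 2}
    (hp : p ∘ g ∈ V) : p ∈ V := by
  have key : ∀ (m : ℕ) (q : (ι → ZMod 2) → ZMod 2), q ∈ V → q ∘ (g ^ m : Equiv.Perm _) ∈ V := by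
    intro m
    induction m with
    | zero => intro q hq; exact hq
    | succ m ih =>
      intro q hq
      have : q ∘ (g ^ (m + 1) : Equiv.Perm _) = (q ∘ (g ^ m : Equiv.Perm _)) ∘ g := by
        rw [pow_succ]; rfl
      rw [this]; exact hV _ (ih q hq)
  have h1 : (p ∘ g) ∘ (g ^ (orderOf g - 1) : Equiv.Perm _) = p := by
    have : g * g ^ (orderOf g - 1) = 1 := by
      rw [← pow_succ', Nat.sub_add_cancel (orderOf_pos g), pow_orderOf_eq_one]
    funext w
    change p ((g * g ^ (orderOf g - 1)) w) = p w
    rw [this]; rfl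
  rw [← h1]; exact key _ _ hp

/-- The permutation that adds `p` to the letter `w_a`. -/
def shear (a : ι) (p : (ι → ZMod 2) → ZMod 2) (hp : Free a p) : Equiv.Perm (ι → ZMod 2) :=
  Function.Involutive.toPerm (fun w => Function.update w a (w a + p w)) (by
    intro w
    simp only [hp w, Function.update_self, Function.update_idem]
    rw [add_assoc, zmod_two_add_self, add_zero, Function.update_eq_self])

variable {a : ι} {p : (ι → ZMod 2) → ZMod 2} (hp : Free a p)

theorem shear_apply (w : ι → ZMod 2) :
    shear a p hp w = Function.update w a (w a + p w) := rfl

theorem shear_mul_self : shear a p hp * shear a p hp = 1 :=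
  inv_mul_cancel (shear a p hp)

theorem disp_shear_self : disp (shear a p hp) a = p := by
  funext w
  rw [disp, shear_apply, Function.update_self, add_comm, ← add_assoc, zmod_two_add_self, zero_add]

theorem disp_shear_of_ne {b : ι} (h : b ≠ a) : disp (shear a p hp) b = 0 := by
  funext w
  rw [disp, shear_apply, Function.update_of_ne h, zmod_two_add_self]; rfl

theorem comp_shear (q : (ι → ZMod 2) → ZMod 2) :
    q ∘ shear a p hp = q + p * pderiv a q :=
  funext fun w => apply_update_add q a w (p w)

theorem comp_shear_of_free {q : (ι → ZMod 2) → ZMod 2} (hq : Free a q) :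
    q ∘ shear a p hp = q := by
  rw [comp_shear, pderiv_of_free hq, mul_zero, add_zero]

theorem shear_mem_tableaux {S : ι → Set (Finset ι)} :
    shear a p hp ∈ tableaux S ↔ p ∈ mspan (S a) := by
  refine ⟨fun h => disp_shear_self hp ▸ h a, fun h b => ?_⟩
  by_cases hb : b = a
  · subst hb; rwa [disp_shear_self]
  · rw [disp_shear_of_ne hp hb]; exact zero_mem _

end Shear

/-- The monomials in the letters before `w_a`. -/
def triangular (a : ι) : Set (Finset ι) := {X | ∀ x ∈ X, x < a}

theorem triangular_saturated : Saturated (triangular (ι := ι)) where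
  lt _ _ h := h
  empty_mem a := by simp [triangular]
  comm_mem a X hX b hb Y hY x hx := by
    rcases Finset.mem_union.1 hx with h | h
    · exact hX x (Finset.mem_of_mem_erase h)
    · exact (hY x h).trans (hX b hb)

theorem Saturated.subset_triangular {S : ι → Set (Finset ι)} (hS : Saturated S) (a : ι) :
    S a ⊆ triangular a := hS.lt a

theorem free_of_mem_triangular {a k : ι} (h : a ≤ k) {p : (ι → ZMod 2) → ZMod 2}
    (hp : p ∈ mspan (triangular a)) : Free k p :=
  Free.of_mem_mspan (D := triangular a) (fun _ (hX : ∀ x ∈ _, x < a) hk => absurd (hX k hk) (not_lt.2 h)) hp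

/-- Every triangular permutation is a product of shears at increasing letters. -/
theorem triangular_induction [Fintype ι] {S : ι → Set (Finset ι)}
    (hS : ∀ a, S a ⊆ triangular a) {P : Equiv.Perm (ι → ZMod 2) → Prop} (h1 : P 1)
    (hstep : ∀ (k : ι) (g : Equiv.Perm (ι → ZMod 2)), g ∈ tableaux S →
      (∀ a, k ≤ a → disp g a = 0) → ∀ (p : (ι → ZMod 2) → ZMod 2) (hp : p ∈ mspan (S k)),
      P g → P (g * shear k p (free_of_mem_triangular le_rfl (mspan_mono (hS k) hp))))
    {g : Equiv.Perm (ι → ZMod 2)} (hg : g ∈ tableaux S) : P g := by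
  have key : ∀ U : Finset ι, ∀ g ∈ tableaux S,
      (∀ a, a ∉ U → disp g a = 0) → P g := by
    intro U
    induction U using Finset.induction_on_max with
    | empty =>
      intro g _ hg
      have : g = 1 := by
        ext w a
        rw [apply_eq_disp_add, hg a (Finset.notMem_empty a)]
        simp
      rwa [this]
    | insert k U hU ih =>
      intro g hg hgU
      have hfree : Free k (disp g k) := free_of_mem_triangular le_rfl (mspan_mono (hS k) (hg k))
      -- Multiplying by `e` on the right cancels the displacement at the largest active letter;
      -- smaller letters do not see `w_k` and keep theirs.
      set e := shear k (disp g k) hfree with he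
      have hd1 : ∀ a, a < k → disp (g * e) a = disp g a := fun a ha => by
        rw [disp_mul, comp_shear_of_free _ (free_of_mem_triangular ha.le (mspan_mono (hS a) (hg a))),
          disp_shear_of_ne _ ha.ne, add_zero]
      have hd2 : ∀ a, k ≤ a → disp (g * e) a = 0 := fun a ha => by
        rcases ha.eq_or_lt with rfl | ha
        · rw [disp_mul, comp_shear_of_free _ hfree, disp_shear_self, fun_add_self]
        · rw [disp_mul, disp_shear_of_ne _ ha.ne', hgU a]
          · rfl
          · intro h
            rcases Finset.mem_insert.1 h with rfl | h
            · exact lt_irrefl _ ha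
            · exact lt_asymm ha (hU a h)
      have hge : g * e ∈ tableaux S := fun a => by
        rcases lt_or_ge a k with h | h
        · rw [hd1 a h]; exact hg a
        · rw [hd2 a h]; exact zero_mem _
      have := hstep k (g * e) hge hd2 (disp g k) (hg k) (ih _ hge fun a ha => ?_)
      · rwa [← he, mul_assoc, he, shear_mul_self, mul_one] at this
      · rcases lt_or_ge a k with h | h
        · rw [hd1 a h]
          refine hgU a fun ha' => ?_
          rcases Finset.mem_insert.1 ha' with rfl | h'
          · exact lt_irrefl _ h
          · exact ha h'
        · exact hd2 a h
  exact key Finset.univ g hg fun a ha => absurd (Finset.mem_univ a) ha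

section Group

variable {S : ι → Set (Finset ι)}

theorem Saturated.mul_mem (hS : Saturated S) {g h : Equiv.Perm (ι → ZMod 2)}
    (hg : g ∈ tableaux S) (hh : h ∈ tableaux S) : g * h ∈ tableaux S := fun a => by
  rw [disp_mul]
  exact add_mem (comp_mem_mspan hh hS.lt (hS.comm_mem a) (hg a)) (hh a)

omit [LinearOrder ι] in
theorem one_mem_tableaux : (1 : Equiv.Perm (ι → ZMod 2)) ∈ tableaux S := fun a => by
  rw [disp_one]; exact zero_mem _

/-- The subgroup of the permutations with displacements in the span of a saturated system. -/
def Saturated.group [Finite ι] (hS : Saturated S) : Subgroup (Equiv.Perm (ι → ZMod 2)) where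
  carrier := tableaux S
  mul_mem' := hS.mul_mem
  one_mem' := one_mem_tableaux
  inv_mem' {g} hg := by
    have h1 : g⁻¹ = g ^ (orderOf g - 1) := by
      refine inv_eq_of_mul_eq_one_right ?_
      rw [← pow_succ', Nat.sub_add_cancel (orderOf_pos g), pow_orderOf_eq_one]
    have key : ∀ m : ℕ, g ^ m ∈ tableaux S := by
      intro m
      induction m with
      | zero => exact one_mem_tableaux
      | succ m ih => rw [pow_succ]; exact hS.mul_mem ih hg
    rw [h1]
    exact key _

/-- The permutation that adds to the letter `w_a` the part of the monomial `X` before `w_a`. -/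
def rigid (a : ι) (X : Finset ι) : Equiv.Perm (ι → ZMod 2) :=
  shear a (mono (X.filter (· < a))) (Free.mono (by simp))

theorem filter_of_mem_triangular {a : ι} {X : Finset ι} (hX : X ∈ triangular a) :
    X.filter (· < a) = X := Finset.filter_true_of_mem hX

theorem rigid_eq_shear {a : ι} {X : Finset ι} (hX : X ∈ triangular a) (h : Free a (mono X)) :
    rigid a X = shear a (mono X) h := by
  simp only [rigid, filter_of_mem_triangular hX]

theorem disp_rigid_self {a : ι} {X : Finset ι} (hX : X ∈ triangular a) :
    disp (rigid a X) a = mono X := by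
  rw [rigid, disp_shear_self, filter_of_mem_triangular hX]

theorem disp_rigid_of_ne {a b : ι} (X : Finset ι) (h : b ≠ a) : disp (rigid a X) b = 0 :=
  disp_shear_of_ne _ h

theorem rigid_mem_tableaux {a : ι} {X : Finset ι} (hX : X ∈ triangular a) :
    rigid a X ∈ tableaux S ↔ X ∈ S a := by
  rw [rigid, shear_mem_tableaux, filter_of_mem_triangular hX, mono_mem_mspan_iff]

omit [LinearOrder ι] in
theorem eq_of_disp_eq {g h : Equiv.Perm (ι → ZMod 2)} (H : ∀ a, disp g a = disp h a) : g = h := by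
  ext w a
  rw [apply_eq_disp_add, apply_eq_disp_add, H]

/-- Moving `w_b` by `mono Y` changes `mono X` by `mono Y` times its derivative `mono (X.erase b)`,
and square-free monomials multiply by union. -/
theorem groupComm_rigid {a b : ι} {X Y : Finset ι} (hX : X ∈ triangular a)
    (hY : Y ∈ triangular b) (hb : b ∈ X) :
    groupComm (rigid a X) (rigid b Y) = rigid a (X.erase b ∪ Y) := by
  have hba : b < a := hX b hb
  have hZ : X.erase b ∪ Y ∈ triangular a := triangular_saturated.comm_mem a X hX b hb Y hY
  suffices rigid a X * rigid b Y = rigid b Y * (rigid a X * rigid a (X.erase b ∪ Y)) by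
    rw [groupComm, mul_assoc, this]; group
  have hfX : Free a (mono X) := Free.mono fun h => lt_irrefl _ (hX a h)
  have hfY : Free a (mono Y) := Free.mono fun h => lt_asymm hba (hY a h)
  have hzero : ∀ g : Equiv.Perm (ι → ZMod 2), (0 : (ι → ZMod 2) → ZMod 2) ∘ g = 0 := fun _ => rfl
  refine eq_of_disp_eq fun c => ?_
  rw [disp_mul, disp_mul, disp_mul]
  by_cases hca : c = a
  · subst hca
    rw [disp_rigid_of_ne Y hba.ne', disp_rigid_self hX, disp_rigid_self hZ, hzero, add_zero,
      zero_add, rigid, comp_shear, filter_of_mem_triangular hY, pderiv_mono_of_mem hb, mono_mul,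
      rigid, comp_shear_of_free _ hfX, Finset.union_comm]
  · rw [disp_rigid_of_ne X hca, disp_rigid_of_ne _ hca, hzero, hzero, add_zero, add_zero, zero_add]
    by_cases hcb : c = b
    · subst hcb
      rw [disp_rigid_self hY, Equiv.Perm.coe_mul, ← Function.comp_assoc, rigid,
        comp_shear_of_free _ hfY, rigid, comp_shear_of_free _ hfY]
    · rw [disp_rigid_of_ne Y hcb, hzero]

theorem shear_mem_of_rigid_mem {H : Subgroup (Equiv.Perm (ι → ZMod 2))} {k : ι}
    {D : Set (Finset ι)} (hD : D ⊆ triangular k) (h : ∀ X ∈ D, rigid k X ∈ H)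
    {p : (ι → ZMod 2) → ZMod 2} (hp : p ∈ mspan D) :
    ∃ hpf : Free k p, shear k p hpf ∈ H := by
  refine mspan_induction (P := fun p => ∃ hpf : Free k p, shear k p hpf ∈ H) ?_ ?_ ?_ hp
  · refine ⟨Free.zero k, ?_⟩
    convert H.one_mem
    refine eq_of_disp_eq fun a => ?_
    rw [disp_one]
    by_cases ha : a = k
    · subst ha; rw [disp_shear_self]
    · rw [disp_shear_of_ne _ ha]
  · rintro p q ⟨hp, hpH⟩ ⟨hq, hqH⟩
    refine ⟨hp.add hq, ?_⟩
    convert H.mul_mem hpH hqH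
    refine eq_of_disp_eq fun a => ?_
    rw [disp_mul]
    by_cases ha : a = k
    · subst ha; rw [disp_shear_self, disp_shear_self, disp_shear_self, comp_shear_of_free _ hp]
    · rw [disp_shear_of_ne _ ha, disp_shear_of_ne _ ha, disp_shear_of_ne _ ha, add_zero]; rfl
  · intro X hX
    have hf : Free k (mono X) := Free.mono fun h => lt_irrefl _ (hD hX k h)
    exact ⟨hf, rigid_eq_shear (hD hX) hf ▸ h X hX⟩

/-- A saturated subgroup is generated by its rigid commutators. -/
theorem mem_of_rigid_mem [Fintype ι] {H : Subgroup (Equiv.Perm (ι → ZMod 2))}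
    (hS : ∀ a, S a ⊆ triangular a) (h : ∀ a, ∀ X ∈ S a, rigid a X ∈ H)
    {g : Equiv.Perm (ι → ZMod 2)} (hg : g ∈ tableaux S) : g ∈ H := by
  refine triangular_induction hS (P := fun g => g ∈ H) H.one_mem ?_ hg
  intro k g _ _ p hp hgH
  exact H.mul_mem hgH (shear_mem_of_rigid_mem (hS k) (h k) hp).2

end Group

end Groups

/-! ### The normalizer of a saturated group. -/

section Normalizer

variable {ι : Type*} [LinearOrder ι] [Fintype ι]

/-- A triangular permutation that preserves the span of a simplicial complex of monomials
preserves it letter by letter. -/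
theorem disp_mul_mem_of_comp_mem {D : Set (Finset ι)} {g : Equiv.Perm (ι → ZMod 2)}
    (hg : g ∈ tableaux triangular)
    (hV : ∀ p ∈ mspan D, p ∘ g ∈ mspan D) (a : ι) :
    ∀ q ∈ mspan {Z | a ∉ Z ∧ insert a Z ∈ D}, disp g a * q ∈ mspan D := by
  revert hV a
  refine triangular_induction (fun _ => subset_rfl) (P := fun g => (∀ p ∈ mspan D, p ∘ g ∈ mspan D) →
    ∀ a, ∀ q ∈ mspan {Z | a ∉ Z ∧ insert a Z ∈ D}, disp g a * q ∈ mspan D) ?_ ?_ hg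
  · intro _ a q _
    rw [disp_one, zero_mul]; exact zero_mem _
  · intro k g hg hgk p hp ih hV
    have hpf : Free k p := free_of_mem_triangular le_rfl hp
    have hgf : ∀ q, Free k q → Free k (q ∘ g) := by
      intro q hq w c
      have : g (Function.update w k c) = Function.update (g w) k (g (Function.update w k c) k) := by
        funext a
        rcases lt_trichotomy a k with h | rfl | h
        · rw [Function.update_of_ne h.ne, apply_eq_disp_add, apply_eq_disp_add,
            free_of_mem_triangular h.le (hg a), Function.update_of_ne h.ne]
        · rw [Function.update_self]
        · rw [Function.update_of_ne h.ne', apply_eq_disp_add, apply_eq_disp_add,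
            hgk a h.le, Function.update_of_ne h.ne']
          rfl
      change q (g (Function.update w k c)) = q (g w)
      rw [this, hq]
    have hqf : ∀ q ∈ mspan {Z | k ∉ Z ∧ insert k Z ∈ D}, Free k q := fun q hq =>
      Free.of_mem_mspan (D := {Z | k ∉ Z ∧ insert k Z ∈ D}) (fun Z hZ => hZ.1) hq
    -- The image of `mono {k} * q` is affine in `w_k`. Its derivative recovers `q ∘ g`, and its
    -- value at `w_k = 1` isolates `p * (q ∘ g)`; both operations preserve the spans. Hence the last
    -- shear preserves `mspan D`, and so does `g`.
    have hsplit : ∀ q ∈ mspan {Z | k ∉ Z ∧ insert k Z ∈ D},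
        mono {k} * (q ∘ g) + p * (q ∘ g) ∈ mspan D := by
      intro q hq
      have h1 : mono {k} * q ∈ mspan D :=
        mul_mem_mspan (A := {{k}}) (by rintro _ rfl Z hZ; exact hZ.2) (mono_mem_mspan rfl) hq
      have h2 := hV _ h1
      have h3 : (mono {k} * q) ∘ (g * shear k p hpf : Equiv.Perm _)
          = mono {k} * (q ∘ g) + p * (q ∘ g) := by
        funext w
        have h4 : q (g (shear k p hpf w)) = q (g w) :=
          congrFun (comp_shear_of_free hpf (hgf q (hqf q hq))) w
        have h5 : g (shear k p hpf w) k = w k + p w := by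
          rw [apply_eq_disp_add, hgk k le_rfl, shear_apply, Function.update_self]
          exact zero_add _
        change mono {k} (g (shear k p hpf w)) * q (g (shear k p hpf w))
          = mono {k} w * q (g w) + p w * q (g w)
        rw [h4, mono_singleton, h5, mono_singleton]
        ring
      rwa [h3] at h2
    have hV1 : ∀ q ∈ mspan {Z | k ∉ Z ∧ insert k Z ∈ D},
        q ∘ g ∈ mspan {Z | k ∉ Z ∧ insert k Z ∈ D} := by
      intro q hq
      have h1 := pderiv_mem_mspan (k := k) (hsplit q hq)
      have hf := hgf q (hqf q hq)
      rwa [map_add, pderiv_var_mul hf, pderiv_of_free (hpf.mul hf), add_zero] at h1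
    have hpV1 : ∀ q ∈ mspan {Z | k ∉ Z ∧ insert k Z ∈ D}, p * q ∈ mspan D := by
      intro q hq
      have hback : (q ∘ (g⁻¹ : Equiv.Perm _)) ∘ g = q := by
        funext w; simp
      have h1 : q ∘ (g⁻¹ : Equiv.Perm _) ∈ mspan {Z | k ∉ Z ∧ insert k Z ∈ D} :=
        mem_of_comp_mem hV1 (by rwa [hback])
      have h2 := special_mem_mspan (k := k) (hsplit _ h1)
      rw [hback] at h2
      rwa [map_add, special_var_mul, special_of_free (hpf.mul (hqf q hq)), zero_add] at h2
    have hVe : ∀ q ∈ mspan D, q ∘ shear k p hpf ∈ mspan D := by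
      intro q hq
      rw [comp_shear]
      exact add_mem hq (hpV1 _ (pderiv_mem_mspan hq))
    have hVg : ∀ q ∈ mspan D, q ∘ g ∈ mspan D := by
      intro q hq
      have h1 := hVe _ (hV q hq)
      have h2 : (q ∘ (g * shear k p hpf : Equiv.Perm _)) ∘ shear k p hpf = q ∘ g := by
        change q ∘ ((g * shear k p hpf) * shear k p hpf : Equiv.Perm _) = q ∘ g
        rw [mul_assoc, shear_mul_self, mul_one]
      rwa [h2] at h1
    intro a q hq
    rw [disp_mul]
    rcases lt_trichotomy a k with h | rfl | h
    · rw [comp_shear_of_free _ (free_of_mem_triangular h.le (hg a)), disp_shear_of_ne _ h.ne,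
        add_zero]
      exact ih hVg a q hq
    · rw [hgk a le_rfl, disp_shear_self]
      have : (0 : (ι → ZMod 2) → ZMod 2) ∘ shear a p hpf + p = p := by
        funext w; exact zero_add _
      rw [this]
      exact hpV1 q hq
    · rw [hgk a h.le, disp_shear_of_ne _ h.ne']
      have : ((0 : (ι → ZMod 2) → ZMod 2) ∘ shear k p hpf + 0) * q = 0 := by
        funext w; simp
      rw [this]
      exact zero_mem _

/-- The rigid commutators whose commutators with those of the system `S` lie in `S`. -/
def normalizing (S : ι → Set (Finset ι)) (a : ι) : Set (Finset ι) :=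
  {X | X ∈ triangular a ∧ (∀ b ∈ X, ∀ Y ∈ S b, X.erase b ∪ Y ∈ S a) ∧
    ∀ b, ∀ Y ∈ S b, a ∈ Y → Y.erase a ∪ X ∈ S b}

omit [LinearOrder ι] [Fintype ι] in
-- Reading the conjugate at `g w` keeps `g⁻¹` out of the formula; it compares the displacements in
-- `(g * h * g⁻¹) * g = g * h`.
theorem disp_conj_comp (g h : Equiv.Perm (ι → ZMod 2)) (a : ι) :
    disp (g * h * g⁻¹) a ∘ g = (disp g a ∘ h + disp g a) + disp h a := by
  have h1 : disp (g * h * g⁻¹) a ∘ g + disp g a = disp g a ∘ h + disp h a := by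
    rw [← disp_mul, ← disp_mul, inv_mul_cancel_right]
  calc disp (g * h * g⁻¹) a ∘ g = disp (g * h * g⁻¹) a ∘ g + disp g a + disp g a := by
        rw [add_assoc, fun_add_self, add_zero]
    _ = _ := by rw [h1]; exact add_right_comm _ _ _

namespace Saturated

variable {S : ι → Set (Finset ι)}

/-- The two clauses of `normalizing` play separate roles: the second makes each span stable under
`g`, the first puts `disp g a ∘ h + disp g a` into the span of `S a`. -/
theorem conj_mem (hS : Saturated S) {g h : Equiv.Perm (ι → ZMod 2)}
    (hg : g ∈ tableaux (normalizing S)) (hh : h ∈ hS.group) : g * h * g⁻¹ ∈ hS.group := by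
  intro a
  have hV : ∀ p ∈ mspan (S a), p ∘ g ∈ mspan (S a) := fun p hp =>
    comp_mem_mspan hg (fun b Y hY => hY.1) (fun X hX b hb Y hY => hY.2.2 a X hX hb) hp
  refine mem_of_comp_mem hV ?_
  rw [disp_conj_comp]
  refine add_mem (comp_add_mem_mspan hh hS.lt ?_ (fun X hX b hb Y hY => hX.2.1 b hb Y hY) (hg a))
    (hh a)
  intro X hX b hb Y hY
  have := hX.2.1 b hb Y hY
  exact ⟨hS.lt a _ this, hS.comm_mem a _ this,
    fun c Z hZ ha => hS.comm_mem c Z hZ a ha _ this⟩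

/-- Conjugating shears shows that `g` preserves every span of `S b` and that the derivatives of
`disp g a`, times monomials of `S b`, stay in the span of `S a`. As the index sets are simplicial
complexes, `union_mem_of_mul_mem` passes from these products to the individual monomials of `disp g
a`. -/
theorem mem_normalizing_of_conj_mem (hS : Saturated S) {g : Equiv.Perm (ι → ZMod 2)}
    (hgt : g ∈ tableaux triangular) (hg : ∀ h ∈ hS.group, g * h * g⁻¹ ∈ hS.group) :
    g ∈ tableaux (normalizing S) := by
  have hVinv : ∀ b, ∀ p ∈ mspan (S b), p ∘ (g⁻¹ : Equiv.Perm _) ∈ mspan (S b) := by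
    intro b p hp
    have hpf : Free b p := free_of_mem_triangular le_rfl (mspan_mono (hS.lt b) hp)
    have h1 := disp_conj_comp g (shear b p hpf) b
    rw [comp_shear_of_free hpf (free_of_mem_triangular le_rfl (hgt b)), fun_add_self, zero_add,
      disp_shear_self] at h1
    have h2 : p ∘ (g⁻¹ : Equiv.Perm _) = disp (g * shear b p hpf * g⁻¹) b := by
      funext w
      have h3 := congrFun h1 (g⁻¹ w)
      simpa using h3.symm
    rw [h2]
    exact hg _ ((shear_mem_tableaux hpf).2 hp) b
  have hV : ∀ b, ∀ p ∈ mspan (S b), p ∘ g ∈ mspan (S b) := by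
    intro b p hp
    refine mem_of_comp_mem (hVinv b) ?_
    have : (p ∘ g) ∘ (g⁻¹ : Equiv.Perm _) = p := by funext w; simp
    rwa [this]
  intro a
  refine mem_mspan_iff.2 fun X hX => ⟨mem_of_coeff_ne_zero (hgt a) hX, ?_, ?_⟩
  · intro b hb Y hY
    refine union_mem_of_mul_mem (D := S b) (f := pderiv b (disp g a))
      (fun Z hZ Y hYZ => hS.subset_mem hZ hYZ) ?_ ?_ hY
    · intro Z hZ
      have hf : Free b (mono Z) := Free.mono fun h => lt_irrefl _ (hS.lt b Z hZ b h)
      have hs : shear b (mono Z) hf ∈ hS.group :=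
        (shear_mem_tableaux hf).2 (mono_mem_mspan hZ)
      have h1 := hV a _ (hg _ hs a)
      rw [disp_conj_comp, comp_shear, add_right_comm (disp g a), fun_add_self, zero_add] at h1
      have h2 := add_mem h1 (hs a)
      rwa [add_assoc, fun_add_self, add_zero, mul_comm] at h2
    · rwa [← coeff_insert (Finset.notMem_erase _ _), Finset.insert_erase hb]
  · intro b Y hY ha
    rw [Finset.union_comm]
    refine union_mem_of_mul_mem (D := {Z | a ∉ Z ∧ insert a Z ∈ S b}) (f := disp g a) ?_ ?_ hX ?_
    · intro Z hZ Y hYZ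
      exact ⟨fun h => hZ.1 (hYZ h), hS.subset_mem hZ.2 (Finset.insert_subset_insert a hYZ)⟩
    · intro Z hZ
      exact disp_mul_mem_of_comp_mem hgt (hV b) a _
        (mono_mem_mspan hZ)
    · exact ⟨Finset.notMem_erase _ _, by rwa [Finset.insert_erase ha]⟩

/-- The normalizer of a saturated subgroup among the triangular permutations is given by the
rigid commutators that normalize it. -/
theorem mem_normalizer_iff (hS : Saturated S) {g : Equiv.Perm (ι → ZMod 2)} :
    (g ∈ Subgroup.normalizer (hS.group : Set (Equiv.Perm (ι → ZMod 2))) ∧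
      g ∈ tableaux triangular) ↔ g ∈ tableaux (normalizing S) := by
  constructor
  · rintro ⟨hg, hgt⟩
    exact hS.mem_normalizing_of_conj_mem hgt fun h hh =>
      (Subgroup.mem_set_normalizer_iff.1 hg h).1 hh
  · intro hg
    exact ⟨Subgroup.mem_normalizer_fintype fun h hh => hS.conj_mem hg hh,
      tableaux_mono (fun a X hX => hX.1) hg⟩

end Saturated

end Normalizer

/-! ### Generators, punctured commutators and translations as shears. -/

section Words

variable {n : ℕ}

/-- The letter indices `i` (shifted by one) that belong to a set of positive integers. -/
def positions (n : ℕ) (X : Finset ℕ) : Finset (Fin n) :=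
  Finset.univ.filter fun i => (i : ℕ) + 1 ∈ X

theorem mem_positions {X : Finset ℕ} {i : Fin n} : i ∈ positions n X ↔ (i : ℕ) + 1 ∈ X := by
  simp [positions]

/-- The set of positive integers given by a set of letter indices. -/
def parts (X : Finset (Fin n)) : Finset ℕ := X.image fun i : Fin n => (i : ℕ) + 1

theorem mem_parts {X : Finset (Fin n)} {i : ℕ} : i ∈ parts X ↔ ∃ j ∈ X, (j : ℕ) + 1 = i :=
  Finset.mem_image

theorem succ_mem_parts {X : Finset (Fin n)} {j : Fin n} : (j : ℕ) + 1 ∈ parts X ↔ j ∈ X := by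
  rw [mem_parts]
  refine ⟨?_, fun h => ⟨j, h, rfl⟩⟩
  rintro ⟨i, hi, e⟩
  rwa [← Fin.ext (show (i : ℕ) = j by omega)]

theorem positions_parts (X : Finset (Fin n)) : positions n (parts X) = X := by
  ext i
  rw [mem_positions, succ_mem_parts]

theorem treeGen_eq_rigid (k : Fin n) : treeGen n (k + 1) = rigid k (Finset.univ.filter (· < k)) := by
  ext w j
  have hmem : Finset.univ.filter (· < k) ∈ triangular k := fun x hx => by simpa using hx
  change treeGenFun n (k + 1) w j = _
  rw [apply_eq_disp_add]
  by_cases hj : j = k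
  · subst hj
    rw [disp_rigid_self hmem, treeGenFun]
    by_cases h : ∀ l : Fin n, l < j → w l = 0
    · rw [if_pos ⟨rfl, h⟩, mono_eq_one (by simpa using h), add_comm]
    · rw [if_neg (fun h' => h h'.2), mono_eq_zero (by simpa using h), zero_add]
  · rw [disp_rigid_of_ne _ hj, treeGenFun, if_neg]
    · exact (zero_add _).symm
    · rintro ⟨h, -⟩
      exact hj (Fin.ext (by omega))

theorem treeGen_eq_one {i : ℕ} (hi : n < i) : treeGen n i = 1 := by
  ext w j
  change treeGenFun n i w j = w j
  rw [treeGenFun, if_neg]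
  rintro ⟨h, -⟩
  have := j.2
  omega

/-- The indices decrease, so when `s_i` is applied all letters before `i` are still in `X`: the
commutator merely deletes the letter `i`. -/
theorem foldl_groupComm_rigid {a : Fin n} (l : List ℕ) (hl : l.Pairwise (· > ·))
    (h1 : ∀ i ∈ l, 1 ≤ i) {X : Finset (Fin n)} (hX : X ∈ triangular a)
    (hlX : ∀ i ∈ l, i ≤ a ∧ ∀ j : Fin n, (j : ℕ) + 1 ≤ i → j ∈ X) :
    (l.map (treeGen n)).foldl groupComm (rigid a X)
      = rigid a (X.filter fun j => (j : ℕ) + 1 ∉ l) := by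
  induction l generalizing X with
  | nil => simp
  | cons i l ih =>
    obtain ⟨hil, hl'⟩ := List.pairwise_cons.1 hl
    obtain ⟨hia, hiX⟩ := hlX i (by simp)
    have hi1 := h1 i (by simp)
    have ha := a.2
    obtain ⟨k, rfl⟩ : ∃ k : Fin n, (k : ℕ) + 1 = i := ⟨⟨i - 1, by omega⟩, by simp; omega⟩
    have hsub : X.erase k ∪ Finset.univ.filter (· < k) = X.erase k := by
      refine Finset.union_eq_left.2 fun j hj => ?_
      have hjk : j < k := by simpa using hj
      exact Finset.mem_erase.2 ⟨hjk.ne, hiX j (by have : (j : ℕ) < k := hjk; omega)⟩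
    rw [List.map_cons, List.foldl_cons, treeGen_eq_rigid,
      groupComm_rigid hX (fun x hx => by simpa using hx) (hiX k le_rfl), hsub,
      ih hl' (fun i hi => h1 i (by simp [hi])) (fun x hx => hX x (Finset.mem_of_mem_erase hx))]
    · congr 1
      ext j
      simp only [Finset.mem_filter, Finset.mem_erase, List.mem_cons, not_or, ne_eq,
        add_left_inj, Fin.ext_iff]
      tauto
    · intro i hi
      have hik := hil i hi
      refine ⟨by omega, fun j hj => Finset.mem_erase.2 ⟨?_, hiX j (by omega)⟩⟩
      rintro rfl
      omega

theorem leftNormedComm_cons {k : Fin n} {l : List ℕ} (hl : ((k + 1 : ℕ) :: l).Pairwise (· > ·))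
    (h1 : ∀ i ∈ l, 1 ≤ i) :
    leftNormedComm ((((k : ℕ) + 1) :: l).map (treeGen n))
      = rigid k (Finset.univ.filter fun j => j < k ∧ (j : ℕ) + 1 ∉ l) := by
  obtain ⟨hil, hl'⟩ := List.pairwise_cons.1 hl
  rw [List.map_cons, leftNormedComm, treeGen_eq_rigid, foldl_groupComm_rigid l hl' h1]
  · rw [Finset.filter_filter]
  · exact fun x hx => by simpa using hx
  · intro i hi
    have hik := hil i hi
    refine ⟨by omega, fun j hj => ?_⟩
    rw [Finset.mem_filter, Fin.lt_def]
    exact ⟨Finset.mem_univ _, by omega⟩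

theorem foldl_groupComm_one {G : Type*} [Group G] (l : List G) :
    l.foldl groupComm 1 = 1 := by
  induction l with
  | nil => rfl
  | cons g l ih =>
    rw [List.foldl_cons]
    have : groupComm 1 g = 1 := by simp [groupComm]
    rw [this, ih]

theorem sort_sdiff_eq_cons {a : ℕ} {X : Finset ℕ} (ha : 1 ≤ a) (haX : a ∉ X) :
    ∃ l : List ℕ, (Finset.Icc 1 a \ X).sort (· ≥ ·) = a :: l ∧ (a :: l).Pairwise (· > ·) ∧
      ∀ i, i ∈ l ↔ 1 ≤ i ∧ i < a ∧ i ∉ X := by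
  have hs := (Finset.sortedGT_sort (Finset.Icc 1 a \ X)).pairwise
  have hm : ∀ i, i ∈ (Finset.Icc 1 a \ X).sort (· ≥ ·) ↔ (1 ≤ i ∧ i ≤ a) ∧ i ∉ X := fun i => by
    rw [Finset.mem_sort, Finset.mem_sdiff, Finset.mem_Icc]
  cases hl : (Finset.Icc 1 a \ X).sort (· ≥ ·) with
  | nil =>
    have := (hm a).2 ⟨⟨ha, le_rfl⟩, haX⟩
    rw [hl] at this
    simp at this
  | cons b l =>
    rw [hl] at hs hm
    have hbl := (List.pairwise_cons.1 hs).1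
    have hb := (hm b).1 (by simp)
    have hba : b = a := by
      rcases List.mem_cons.1 ((hm a).2 ⟨⟨ha, le_rfl⟩, haX⟩) with h | h
      · exact h.symm
      · have := hbl a h
        omega
    subst hba
    refine ⟨l, rfl, hs, fun i => ⟨fun h => ?_, fun h => ?_⟩⟩
    · have h2 := (hm i).1 (by simp [h])
      exact ⟨h2.1.1, hbl i h, h2.2⟩
    · rcases List.mem_cons.1 ((hm i).2 ⟨⟨h.1, h.2.1.le⟩, h.2.2⟩) with h' | h'
      · omega
      · exact h'

theorem punctured_eq_rigid (k : Fin n) {X : Finset ℕ} (hX : (k : ℕ) + 1 ∉ X) :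
    punctured n (k + 1) X = rigid k (positions n X) := by
  obtain ⟨l, hl, hp, hm⟩ := sort_sdiff_eq_cons (Nat.succ_pos k) hX
  rw [punctured, hl, leftNormedComm_cons hp fun i hi => ((hm i).1 hi).1]
  have : (Finset.univ.filter fun j : Fin n => j < k ∧ (j : ℕ) + 1 ∉ l)
      = (positions n X).filter (· < k) := by
    ext j
    simp only [Finset.mem_filter, Finset.mem_univ, true_and, hm, mem_positions, Fin.lt_def]
    constructor
    · rintro ⟨h1, h2⟩
      exact ⟨by_contra fun h => h2 ⟨by omega, by omega, h⟩, h1⟩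
    · rintro ⟨h1, h2⟩
      exact ⟨h2, fun h => h.2.2 h1⟩
  simp only [rigid, this, Finset.filter_filter, and_self]

theorem punctured_eq_one {a : ℕ} {X : Finset ℕ} (ha : n < a) (hX : a ∉ X) :
    punctured n a X = 1 := by
  obtain ⟨l, hl, -⟩ := sort_sdiff_eq_cons (by omega) hX
  rw [punctured, hl, List.map_cons, leftNormedComm, treeGen_eq_one ha, foldl_groupComm_one]

theorem leftNormedComm_mem {G : Type*} [Group G] {H : Subgroup G} {l : List G}
    (hl : ∀ g ∈ l, g ∈ H) : leftNormedComm l ∈ H := by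
  cases l with
  | nil => exact H.one_mem
  | cons g l =>
    rw [leftNormedComm]
    induction l generalizing g with
    | nil => exact hl g (by simp)
    | cons h l ih =>
      obtain ⟨hg, hl⟩ := List.forall_mem_cons.1 hl
      obtain ⟨hh, hl⟩ := List.forall_mem_cons.1 hl
      refine ih (groupComm g h) (List.forall_mem_cons.2 ⟨?_, hl⟩)
      exact H.mul_mem (H.mul_mem (H.mul_mem (H.inv_mem hg) (H.inv_mem hh)) hg) hh

theorem rigid_eq_punctured {k : Fin n} {X : Finset (Fin n)} (hX : X ∈ triangular k) :
    rigid k X = punctured n (k + 1) (parts X) := by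
  rw [punctured_eq_rigid, positions_parts]
  rw [succ_mem_parts]
  exact fun h => lt_irrefl _ (hX k h)

/-- Every `rigid k X` is an iterated commutator of generators, and these elements generate all
triangular permutations. -/
theorem mem_sylowTwo_iff {g : Equiv.Perm (Fin n → ZMod 2)} :
    g ∈ sylowTwo n ↔ g ∈ tableaux triangular := by
  constructor
  · intro hg
    have : sylowTwo n ≤ (triangular_saturated (ι := Fin n)).group := by
      refine (Subgroup.closure_le _).2 ?_
      rintro _ ⟨i, hi1, hin, rfl⟩
      obtain ⟨k, rfl⟩ : ∃ k : Fin n, (k : ℕ) + 1 = i := ⟨⟨i - 1, by omega⟩, by simp; omega⟩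
      have hmem : Finset.univ.filter (· < k) ∈ triangular k := fun x hx => by simpa using hx
      rw [treeGen_eq_rigid]
      exact (rigid_mem_tableaux hmem).2 hmem
    exact this hg
  · refine mem_of_rigid_mem (fun _ => subset_rfl) fun k X hX => ?_
    rw [rigid_eq_punctured hX]
    refine leftNormedComm_mem fun g hg => ?_
    obtain ⟨i, hi, rfl⟩ := List.mem_map.1 hg
    rw [Finset.mem_sort, Finset.mem_sdiff, Finset.mem_Icc] at hi
    exact Subgroup.subset_closure ⟨i, hi.1.1, by omega, rfl⟩

theorem singleton_saturated {ι : Type*} [LinearOrder ι] :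
    Saturated (fun _ : ι => ({∅} : Set (Finset ι))) where
  lt := by rintro a _ rfl x hx; simp at hx
  empty_mem a := rfl
  comm_mem := by rintro a _ rfl b hb; simp at hb

theorem translationSubgroup_eq : translationSubgroup n = (singleton_saturated (ι := Fin n)).group := by
  refine le_antisymm ((Subgroup.closure_le _).2 ?_) fun g hg => ?_
  · rintro _ ⟨i, hi1, hin, rfl⟩
    obtain ⟨k, rfl⟩ : ∃ k : Fin n, (k : ℕ) + 1 = i := ⟨⟨i - 1, by omega⟩, by simp; omega⟩
    rw [punctured_eq_rigid k (by simp)]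
    have : positions n ∅ = ∅ := by simp [positions]
    rw [this]
    exact (rigid_mem_tableaux (by simp [triangular])).2 rfl
  · refine mem_of_rigid_mem singleton_saturated.subset_triangular ?_ hg
    rintro k _ rfl
    rw [rigid_eq_punctured (by simp [triangular]), parts, Finset.image_empty]
    exact Subgroup.subset_closure ⟨k + 1, by omega, by omega, rfl⟩

theorem mem_rigidCommutators_iff {g : Equiv.Perm (Fin n → ZMod 2)} :
    g ∈ rigidCommutators n ↔ g = 1 ∨ ∃ k, ∃ X ∈ triangular k, g = rigid k X := by
  constructor
  · rintro ⟨l, hl, hln, rfl⟩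
    cases l with
    | nil => exact Or.inl rfl
    | cons i l =>
      right
      have hi := hln i (by simp)
      obtain ⟨k, rfl⟩ : ∃ k : Fin n, (k : ℕ) + 1 = i := ⟨⟨i - 1, by omega⟩, by simp; omega⟩
      refine ⟨k, _, ?_, leftNormedComm_cons hl fun i hi => (hln i (by simp [hi])).1⟩
      intro x hx
      simp only [Finset.mem_filter] at hx
      exact hx.2.1
  · rintro (rfl | ⟨k, X, hX, rfl⟩)
    · exact ⟨[], by simp, by simp, rfl⟩
    · refine ⟨_, (Finset.sortedGT_sort (Finset.Icc 1 ((k : ℕ) + 1) \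
        parts X)).pairwise, fun i hi => ?_, ?_⟩
      · rw [Finset.mem_sort, Finset.mem_sdiff, Finset.mem_Icc] at hi
        exact ⟨hi.1.1, by omega⟩
      · exact rigid_eq_punctured hX

end Words

/-! ### Weights of sets of letters and the minimal excludant. -/

section Weights

variable {n : ℕ}

/-- The sum of the positions of the letters in `X`, counted from one. -/
def weight (X : Finset (Fin n)) : ℕ := ∑ i ∈ X, ((i : ℕ) + 1)

theorem weight_erase {X : Finset (Fin n)} {b : Fin n} (hb : b ∈ X) :
    weight (X.erase b) + (b + 1) = weight X :=
  Finset.sum_erase_add X (fun i : Fin n => (i : ℕ) + 1) hb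

theorem weight_union_add_inter (X Y : Finset (Fin n)) :
    weight (X ∪ Y) + weight (X ∩ Y) = weight X + weight Y := Finset.sum_union_inter

theorem weight_union_le (X Y : Finset (Fin n)) : weight (X ∪ Y) ≤ weight X + weight Y := by
  rw [← weight_union_add_inter]; exact Nat.le_add_right _ _

theorem weight_union_of_disjoint {X Y : Finset (Fin n)} (h : Disjoint X Y) :
    weight (X ∪ Y) = weight X + weight Y := Finset.sum_union h

theorem le_weight {X : Finset (Fin n)} {x : Fin n} (h : x ∈ X) : (x : ℕ) + 1 ≤ weight X :=
  Finset.single_le_sum (f := fun i : Fin n => (i : ℕ) + 1) (fun _ _ => Nat.zero_le _) h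

theorem weight_union_lt {X Y : Finset (Fin n)} {x : Fin n} (hX : x ∈ X) (hY : x ∈ Y) :
    weight (X ∪ Y) + 1 ≤ weight X + weight Y := by
  rw [← weight_union_add_inter]
  have := le_weight (Finset.mem_inter.2 ⟨hX, hY⟩)
  omega

theorem weight_singleton (x : Fin n) : weight {x} = x + 1 := Finset.sum_singleton _ _

theorem weight_empty : weight (∅ : Finset (Fin n)) = 0 := rfl

theorem weight_comm_le {X Y : Finset (Fin n)} {b : Fin n} (hb : b ∈ X) :
    weight (X.erase b ∪ Y) + (b + 1) ≤ weight X + weight Y := by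
  have h1 := weight_union_le (X.erase b) Y
  have h2 := weight_erase hb
  omega

theorem weight_le_of_card_le_one {Y : Finset (Fin n)} {b : Fin n} (hY : Y ∈ triangular b)
    (h : Y.card ≤ 1) : weight Y ≤ b := by
  have : Nonempty (Fin n) := ⟨b⟩
  obtain ⟨x, hx⟩ := Finset.card_le_one_iff_subset_singleton.1 h
  rcases Finset.subset_singleton_iff.1 hx with rfl | rfl
  · exact Nat.zero_le _
  · rw [weight_singleton]
    have : x < b := hY x (by simp)
    have : (x : ℕ) < b := this
    omega

theorem erase_union_of_card_le_one {X Y : Finset (Fin n)} {b : Fin n} (hb : b ∈ X)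
    (h : X.card ≤ 1) : X.erase b ∪ Y = Y := by
  have : X.erase b = ∅ := by
    rw [← Finset.card_eq_zero, Finset.card_erase_of_mem hb]; omega
  rw [this, Finset.empty_union]

theorem sum_parts (X : Finset (Fin n)) : ∑ x ∈ parts X, x = weight X := by
  rw [parts, Finset.sum_image]
  · rfl
  · intro i _ j _ h
    exact Fin.ext (by simpa using h)

theorem parts_positions {X : Finset ℕ} (h : ∀ x ∈ X, 1 ≤ x ∧ x ≤ n) : parts (positions n X) = X := by
  ext i
  rw [mem_parts]
  constructor
  · rintro ⟨j, hj, rfl⟩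
    exact mem_positions.1 hj
  · intro hi
    obtain ⟨h1, h2⟩ := h i hi
    have e : i - 1 + 1 = i := by omega
    exact ⟨⟨i - 1, by omega⟩, mem_positions.2 (by simpa [e] using hi), e⟩

/-- A non-empty set contains the first letter or a letter whose predecessor it does not contain. -/
theorem exists_pred_notMem_or_zero_mem {X : Finset (Fin n)} (hX : X.Nonempty) :
    (∃ b ∈ X, ∃ c : Fin n, (c : ℕ) + 1 = b ∧ c ∉ X) ∨
      ∃ z ∈ X, (z : ℕ) = 0 := by
  by_cases h : ((X.min' hX : Fin n) : ℕ) = 0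
  · exact Or.inr ⟨_, X.min'_mem hX, h⟩
  · left
    have hlt := (X.min' hX).2
    refine ⟨_, X.min'_mem hX, ⟨(X.min' hX : ℕ) - 1, by omega⟩, by simp; omega, fun hc => ?_⟩
    have := Fin.le_def.1 (X.min'_le _ hc)
    simp only at this
    omega

theorem minExcludant_spec (X : Finset ℕ) : 0 < minExcludant X ∧ minExcludant X ∉ X := by
  refine Nat.sInf_mem (s := {k | 0 < k ∧ k ∉ X}) ⟨∑ x ∈ X, x + 1, Nat.succ_pos _, fun h => ?_⟩
  have := Finset.single_le_sum (f := fun x : ℕ => x) (fun _ _ => Nat.zero_le _) h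
  omega

theorem mem_of_lt_minExcludant {X : Finset ℕ} {i : ℕ} (h0 : 0 < i) (h : i < minExcludant X) :
    i ∈ X := by
  by_contra hi
  exact Nat.notMem_of_lt_sInf h ⟨h0, hi⟩

end Weights

/-! ### The normalizer chain on the level of monomials. -/

section Levels

variable {n : ℕ}

/-- The rigid commutators of the `j`-th normalizer, for `j ≤ n - 2`. -/
def level (n j : ℕ) (a : Fin n) : Set (Finset (Fin n)) :=
  {X | X ∈ triangular a ∧ (X.card ≤ 1 ∨ weight X + n ≤ a + j + 3)}

theorem singleton_mem_level {j : ℕ} {a x : Fin n} (h : x < a) : {x} ∈ level n j a :=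
  ⟨by simpa [triangular] using h, Or.inl (by simp)⟩

/-- For `j ≤ n - 2` every `Y` at the letter `b` weighs at most `b + 1`, the weight of the letter it
replaces, so replacements do not increase the weight. -/
theorem level_saturated {j : ℕ} (hj : j + 2 ≤ n) : Saturated (level n j) where
  lt a X hX := hX.1
  empty_mem a := ⟨triangular_saturated.empty_mem a, Or.inl (by simp)⟩
  comm_mem := by
    rintro a X ⟨hXt, hX⟩ b hb Y ⟨hYt, hY⟩
    have hba : (b : ℕ) < a := hXt b hb
    refine ⟨triangular_saturated.comm_mem a X hXt b hb Y hYt, ?_⟩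
    by_cases h1 : X.card ≤ 1
    · rw [erase_union_of_card_le_one hb h1]
      exact hY.imp id fun h => by omega
    · right
      have hX := hX.resolve_left h1
      have h2 := weight_comm_le (Y := Y) hb
      have h3 : weight Y ≤ b + 1 := by
        rcases hY with h | h
        · have := weight_le_of_card_le_one hYt h
          omega
        · omega
      omega

theorem normalizing_translations :
    normalizing (fun _ : Fin n => ({∅} : Set (Finset (Fin n)))) = level n 0 := by
  funext a
  ext X
  constructor
  · rintro ⟨hXt, hX, -⟩
    refine ⟨hXt, Or.inl ?_⟩
    rcases X.eq_empty_or_nonempty with rfl | ⟨b, hb⟩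
    · simp
    · have : X.erase b = ∅ := by simpa using hX b hb ∅ rfl
      rw [← Finset.insert_erase hb, this]
      simp
  · rintro ⟨hXt, hX⟩
    refine ⟨hXt, ?_, ?_⟩
    · rintro b hb _ rfl
      -- The weight clause is void here: it allows at most weight 2, since `a < n`, while two
      -- letters weigh at least 3.
      have h1 : X.card ≤ 1 := by
        by_contra h
        have hX := hX.resolve_left h
        have ha := a.2
        obtain ⟨c, hc⟩ : (X.erase b).Nonempty := by
          rw [← Finset.card_pos, Finset.card_erase_of_mem hb]; omega
        have h2 := weight_erase hb
        have h3 := le_weight hc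
        have h4 : (c : ℕ) ≠ b := fun e => (Finset.mem_erase.1 hc).1 (Fin.ext e)
        omega
      rw [erase_union_of_card_le_one hb h1]; rfl
    · rintro b _ rfl ha
      simp at ha

/-- For `j ≤ n - 3` a set `Y` weighs strictly less than the letter it replaces, so a weight one
above the bound is brought back. Conversely, singletons and the empty set produce commutators that
lower the weight by exactly one, so nothing heavier normalizes. -/
theorem normalizing_level {j : ℕ} (hj : j + 3 ≤ n) :
    normalizing (level n j) = level n (j + 1) := by
  funext a
  ext X
  constructor
  · rintro ⟨hXt, hX, hX'⟩
    refine ⟨hXt, ?_⟩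
    by_contra! hcon
    obtain ⟨hcard, hw⟩ := hcon
    have ha := a.2
    -- At any letter but the last, the commutator of `{a}` at `a + 1` with `X` carries `X` itself to
    -- `a + 1`, where the bound is larger by only one.
    have han : (a : ℕ) + 1 = n := by
      by_contra h
      have h1 := hX' ⟨a + 1, by omega⟩ {a} (singleton_mem_level (by simp [Fin.lt_def])) (by simp)
      rw [erase_union_of_card_le_one (by simp) (by simp)] at h1
      have h2 := h1.2.resolve_left (by omega)
      simp only at h2
      omega
    rcases exists_pred_notMem_or_zero_mem (X := X) (Finset.card_pos.1 (by omega)) with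
      ⟨b, hb, c, hcb, hc⟩ | ⟨z, hz, hz0⟩
    · have hdisj : Disjoint (X.erase b) {c} :=
        Finset.disjoint_singleton_right.2 fun h => hc (Finset.mem_of_mem_erase h)
      have h1 := (hX b hb {c} (singleton_mem_level (by rw [Fin.lt_def]; omega))).2
      rw [Finset.card_union_of_disjoint hdisj, weight_union_of_disjoint hdisj,
        Finset.card_erase_of_mem hb, weight_singleton, Finset.card_singleton] at h1
      have h2 := weight_erase hb
      omega
    · have h1 := (hX z hz ∅ ((level_saturated (by omega)).empty_mem z)).2
      rw [Finset.union_empty, Finset.card_erase_of_mem hz] at h1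
      have h2 := weight_erase hz
      -- Deleting the first letter settles all cases except a remaining singleton, which every level
      -- admits; then the other letter is lowered instead.
      have hcard2 : (X.erase z).card = 1 := by
        rw [Finset.card_erase_of_mem hz]; omega
      obtain ⟨b, hb⟩ := Finset.card_eq_one.1 hcard2
      have hbX : b ∈ X.erase z := by simp [hb]
      obtain ⟨hbz, hbX⟩ := Finset.mem_erase.1 hbX
      have hb0 : (b : ℕ) ≠ 0 := fun e => hbz (Fin.ext (by omega))
      have hb2 := b.2
      rw [hb, weight_singleton] at h2
      have hlt : (b : ℕ) - 1 < n := by omega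
      have h3 := (hX b hbX {⟨(b : ℕ) - 1, hlt⟩} (singleton_mem_level (by
        rw [Fin.lt_def]; simp only; omega))).2
      have hXe : X.erase b = {z} := by
        have : X = {z, b} := by rw [← hb, Finset.insert_erase hz]
        rw [this]
        ext i; simp; grind
      by_cases hb1 : (b : ℕ) = 1
      · omega
      · have hdisj : Disjoint (X.erase b) {⟨(b : ℕ) - 1, hlt⟩} := by
          rw [hXe, Finset.disjoint_singleton_right, Finset.mem_singleton, Fin.ext_iff]
          simp only
          omega
        rw [Finset.card_union_of_disjoint hdisj, weight_union_of_disjoint hdisj,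
          Finset.card_erase_of_mem hbX, weight_singleton, Finset.card_singleton] at h3
        have h4 := weight_erase hbX
        simp only at h3
        omega
  · rintro ⟨hXt, hX⟩
    refine ⟨hXt, ?_, ?_⟩
    · rintro b hb Y ⟨hYt, hY⟩
      have hba : (b : ℕ) < a := hXt b hb
      refine ⟨triangular_saturated.comm_mem a X hXt b hb Y hYt, ?_⟩
      by_cases h1 : X.card ≤ 1
      · rw [erase_union_of_card_le_one hb h1]
        exact hY.imp id fun h => by omega
      · right
        have hX := hX.resolve_left h1
        have h2 := weight_comm_le (Y := Y) hb
        have h3 : weight Y ≤ b := by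
          rcases hY with h | h
          · exact weight_le_of_card_le_one hYt h
          · omega
        omega
    · rintro b Y ⟨hYt, hY⟩ ha
      have hab : (a : ℕ) < b := hYt a ha
      refine ⟨triangular_saturated.comm_mem b Y hYt a ha X hXt, ?_⟩
      by_cases h1 : Y.card ≤ 1
      · rw [erase_union_of_card_le_one ha h1]
        exact hX.imp id fun h => by omega
      · right
        have hY := hY.resolve_left h1
        have h2 := weight_comm_le (Y := X) ha
        have h3 : weight X ≤ a + 1 := by
          rcases hX with h | h
          · have := weight_le_of_card_le_one hXt h
            omega
          · omega
        omega

theorem mem_level_last (hn : 2 ≤ n) {a : Fin n} {X : Finset (Fin n)} :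
    X ∈ level n (n - 2) a ↔ X ∈ triangular a ∧ weight X ≤ a + 1 := by
  refine and_congr_right fun hX => ⟨?_, fun h => Or.inr (by omega)⟩
  rintro (h | h)
  · have := weight_le_of_card_le_one hX h
    omega
  · omega

/-- The rigid commutators that lie in the last normalizer of the chain and not in the previous
one. -/
def topLayer (n : ℕ) (a : Fin n) : Set (Finset (Fin n)) :=
  {X | X ∈ triangular a ∧ weight X = a + 2 ∧ IsUnrefinablePartition (parts X) ∧
    n < a + 1 + minExcludant (parts X)}

theorem isRefinable_parts {X Y : Finset (Fin n)} (h : Disjoint Y X) {b : Fin n} (hb : b ∈ X)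
    (hY : weight Y = b + 1) : IsRefinable (parts X) := by
  refine ⟨b + 1, succ_mem_parts.2 hb, parts Y, ?_, ?_, by rw [sum_parts, hY]⟩
  · rw [mem_parts]
    rintro ⟨j, -, h⟩
    omega
  · rw [Finset.disjoint_left]
    intro i hi hi'
    obtain ⟨j, hj, rfl⟩ := mem_parts.1 hi
    exact Finset.disjoint_left.1 h hj (succ_mem_parts.1 hi')

/-- Each condition has its test commutator: lowering the weight by one forces `weight X = a + 2`;
replacing a part by a refinement would keep that weight; and a letter `mex X` places after `a` would
receive a set that is too heavy. -/
theorem normalizing_last_subset (hn : 2 ≤ n) {a : Fin n} {X : Finset (Fin n)}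
    (hX : X ∈ normalizing (level n (n - 2)) a) (hw : X ∉ level n (n - 2) a) :
    X ∈ topLayer n a := by
  obtain ⟨hXt, hX, hX'⟩ := hX
  have hlow : ∀ {a : Fin n} {X : Finset (Fin n)}, X ∈ level n (n - 2) a ↔
    X ∈ triangular a ∧ weight X ≤ a + 1 := mem_level_last hn
  rw [hlow] at hw
  have hw : a + 2 ≤ weight X := by
    by_contra h
    exact hw ⟨hXt, by omega⟩
  have hne : X.Nonempty := by
    rw [Finset.nonempty_iff_ne_empty]
    rintro rfl
    rw [weight_empty] at hw
    omega
  have hweq : weight X = a + 2 := by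
    rcases exists_pred_notMem_or_zero_mem hne with ⟨b, hb, c, hcb, hc⟩ | ⟨z, hz, hz0⟩
    · have hdisj : Disjoint (X.erase b) {c} :=
        Finset.disjoint_singleton_right.2 fun h => hc (Finset.mem_of_mem_erase h)
      have h1 := (hlow.1 (hX b hb {c} (singleton_mem_level (by rw [Fin.lt_def]; omega)))).2
      rw [weight_union_of_disjoint hdisj, weight_singleton] at h1
      have h2 := weight_erase hb
      omega
    · have h1 := (hlow.1 (hX z hz ∅ ((level_saturated (by omega)).empty_mem z))).2
      rw [Finset.union_empty] at h1
      have h2 := weight_erase hz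
      omega
  have hle : ∀ i ∈ parts X, 1 ≤ i ∧ i ≤ a := by
    intro i hi
    obtain ⟨j, hj, rfl⟩ := mem_parts.1 hi
    have : (j : ℕ) < a := hXt j hj
    omega
  refine ⟨hXt, hweq, ⟨?_, fun h => ?_, ?_⟩, ?_⟩
  · obtain ⟨x, hx⟩ := hne
    exact ⟨_, succ_mem_parts.2 hx⟩
  · have := hle 0 h
    omega
  · rintro ⟨x, hx, Y, hY0, hYX, hsum⟩
    obtain ⟨b, hb, rfl⟩ := mem_parts.1 hx
    have hYle : ∀ y ∈ Y, 1 ≤ y ∧ y ≤ b := by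
      intro y hy
      have h1 : y ≠ 0 := fun e => hY0 (e ▸ hy)
      have h2 : y ≤ ∑ y ∈ Y, y :=
        Finset.single_le_sum (f := fun x : ℕ => x) (fun _ _ => Nat.zero_le _) hy
      have h3 : y ≠ b + 1 := fun e => Finset.disjoint_left.1 hYX hy (e ▸ hx)
      omega
    have hb2 := b.2
    have hparts : parts (positions n Y) = Y := parts_positions fun y hy => by
      have := hYle y hy
      omega
    have hwY : weight (positions n Y) = b + 1 := by rw [← sum_parts, hparts, ← hsum]
    have hYlow : positions n Y ∈ level n (n - 2) b := by
      refine hlow.2 ⟨fun y hy => ?_, hwY.le⟩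
      have := hYle _ (mem_positions.1 hy)
      rw [Fin.lt_def]
      omega
    have h1 := (hlow.1 (hX b hb _ hYlow)).2
    rw [weight_union_of_disjoint, hwY] at h1
    · have := weight_erase hb
      omega
    · rw [Finset.disjoint_left]
      intro i hi hi'
      exact Finset.disjoint_left.1 hYX (mem_positions.1 hi')
        (succ_mem_parts.2 (Finset.mem_of_mem_erase hi))
  · by_contra hcon
    obtain ⟨hk0, hk⟩ := minExcludant_spec (parts X)
    have hkX := fun i => mem_of_lt_minExcludant (X := parts X) (i := i)
    revert hcon hk0 hk hkX
    generalize minExcludant (parts X) = k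
    intro hcon hk0 hk hkX
    -- Otherwise the parts are `1, …, a`, and `a * (a + 1) = 2 * (a + 2)` has no solution. This
    -- makes the letters `a` and `c` below distinct.
    have hka : k ≠ a + 1 := by
      intro hka
      have : parts X = (Finset.range (a + 1)).erase 0 := by
        ext i
        rw [Finset.mem_erase, Finset.mem_range]
        exact ⟨fun h => by have := hle i h; omega, fun h => hkX i (by omega) (by omega)⟩
      have h1 : ∑ x ∈ parts X, x = ∑ x ∈ Finset.range (a + 1), x := by
        rw [this, Finset.sum_erase]
        rfl
      rw [sum_parts, hweq] at h1
      have h2 := Finset.sum_range_id_mul_two ((a : ℕ) + 1)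
      rw [← h1, Nat.add_sub_cancel] at h2
      rcases Nat.lt_or_ge (a : ℕ) 3 with h | h
      · interval_cases h3 : (a : ℕ) <;> omega
      · nlinarith
    have hk1 : k - 1 + 1 = k := by omega
    -- Counted from one, these are the letters `k` and `a + 1 + k`. The set `{a, c}` has exactly the
    -- maximal weight at `b`, and replacing `a` by `X` adds one, with no overlap since `c ∉ X`.
    let c : Fin n := ⟨k - 1, by omega⟩
    let b : Fin n := ⟨a + k, by omega⟩
    have hc : c ∉ X := fun h => hk (by
      have := succ_mem_parts.2 h
      rwa [show (c : ℕ) + 1 = k from hk1] at this)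
    have hac : a ≠ c := fun e => hka (by rw [e, show (c : ℕ) + 1 = k from hk1])
    have hYw : weight ({a, c} : Finset (Fin n)) = a + 1 + k := by
      rw [Finset.insert_eq, weight_union_of_disjoint (by simpa using hac), weight_singleton,
        weight_singleton, show (c : ℕ) + 1 = k from hk1]
    have hYlow : {a, c} ∈ level n (n - 2) b := by
      refine hlow.2 ⟨?_, ?_⟩
      · intro x hx
        rw [Finset.mem_insert, Finset.mem_singleton] at hx
        rw [Fin.lt_def]
        rcases hx with rfl | rfl <;> simp only [b, c] <;> omega
      · rw [hYw]; simp only [b]; omega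
    have h1 := (hlow.1 (hX' b _ hYlow (by simp))).2
    have he : ({a, c} : Finset (Fin n)).erase a = {c} := by
      rw [Finset.erase_insert (by simpa using hac)]
    rw [he, weight_union_of_disjoint (by simpa using hc), weight_singleton, hweq,
      show (c : ℕ) + 1 = k from hk1] at h1
    simp only [b] at h1
    omega

/-- Only sets `Y` of maximal weight are critical, and then an overlap saves at least one. When `Y`
replaces a part of `X`, unrefinability makes it meet `X`. When `X` replaces `a` in `Y`, the other
letters of `Y` are, counted from one, at most `b - a < mex X`, hence lie in `X`. -/
theorem topLayer_subset_normalizing (hn : 2 ≤ n) {a : Fin n} {X : Finset (Fin n)}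
    (hX : X ∈ topLayer n a) : X ∈ normalizing (level n (n - 2)) a := by
  obtain ⟨hXt, hw, ⟨-, -, hunref⟩, hmex⟩ := hX
  have hlow : ∀ {a : Fin n} {X : Finset (Fin n)}, X ∈ level n (n - 2) a ↔
    X ∈ triangular a ∧ weight X ≤ a + 1 := mem_level_last hn
  refine ⟨hXt, fun b hb Y hY => ?_, fun b Y hY ha => ?_⟩
  · obtain ⟨hYt, hYw⟩ := hlow.1 hY
    refine hlow.2 ⟨triangular_saturated.comm_mem a X hXt b hb Y hYt, ?_⟩
    rcases hYw.eq_or_lt with h | h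
    · have hnd : ¬ Disjoint Y X := fun hd => hunref (isRefinable_parts hd hb h)
      obtain ⟨y, hy, hyX⟩ := Finset.not_disjoint_iff.1 hnd
      have h1 := weight_union_lt (Finset.mem_erase.2 ⟨(hYt y hy).ne, hyX⟩) hy
      have h2 := weight_erase hb
      omega
    · have := weight_comm_le (Y := Y) hb
      omega
  · obtain ⟨hYt, hYw⟩ := hlow.1 hY
    refine hlow.2 ⟨triangular_saturated.comm_mem b Y hYt a ha X hXt, ?_⟩
    have hab : (a : ℕ) < b := hYt a ha
    have hbn := b.2
    have h2 := weight_erase ha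
    rcases hYw.eq_or_lt with h | h
    · have hne : (Y.erase a).Nonempty := by
        rw [Finset.nonempty_iff_ne_empty]
        intro e
        rw [e, weight_empty] at h2
        omega
      obtain ⟨y, hy⟩ := hne
      have h3 := le_weight hy
      have hyX : y ∈ X := succ_mem_parts.1 (mem_of_lt_minExcludant (by omega) (by omega))
      have h1 := weight_union_lt hy hyX
      omega
    · have := weight_comm_le (Y := X) ha
      omega

theorem mem_normalizing_last (hn : 2 ≤ n) {a : Fin n} {X : Finset (Fin n)} :
    X ∈ normalizing (level n (n - 2)) a ↔ X ∈ level n (n - 2) a ∨ X ∈ topLayer n a := by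
  refine ⟨fun h => or_iff_not_imp_left.2 (normalizing_last_subset hn h), ?_⟩
  rintro (h | h)
  · have hs : Saturated (level n (n - 2)) := level_saturated (by omega)
    exact ⟨h.1, hs.comm_mem a X h, fun b Y hY ha => hs.comm_mem b Y hY a ha X h⟩
  · exact topLayer_subset_normalizing hn h

theorem notMem_level_of_mem_topLayer (hn : 2 ≤ n) {a : Fin n} {X : Finset (Fin n)}
    (hX : X ∈ topLayer n a) : X ∉ level n (n - 2) a := fun h => by
  have h1 := (mem_level_last hn).1 h
  have h2 := hX.2.1
  omega

theorem three_le_of_mem_topLayer {b : Fin n} {Y : Finset (Fin n)} (hY : Y ∈ topLayer n b) :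
    3 ≤ (b : ℕ) := by
  by_contra h
  have hsub : parts Y ⊆ Finset.range (b + 1) := by
    intro i hi
    obtain ⟨j, hj, rfl⟩ := mem_parts.1 hi
    have : (j : ℕ) < b := hY.1 j hj
    rw [Finset.mem_range]
    omega
  have h1 : ∑ x ∈ parts Y, x ≤ ∑ x ∈ Finset.range (b + 1), x := Finset.sum_le_sum_of_subset hsub
  rw [sum_parts, hY.2.1] at h1
  have h2 := Finset.sum_range_id_mul_two ((b : ℕ) + 1)
  rw [Nat.add_sub_cancel] at h2
  interval_cases h3 : (b : ℕ) <;> omega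

/-- The commutator of two rigid commutators of the last normalizer lies in the previous one. -/
theorem comm_normalizing_last (hn : 2 ≤ n) {a b : Fin n} {X Y : Finset (Fin n)}
    (hX : X ∈ normalizing (level n (n - 2)) a) (hb : b ∈ X)
    (hY : Y ∈ normalizing (level n (n - 2)) b) : X.erase b ∪ Y ∈ level n (n - 2) a := by
  rcases (mem_normalizing_last hn).1 hY with hYl | hYt
  · exact hX.2.1 b hb Y hYl
  rcases (mem_normalizing_last hn).1 hX with hXl | hXt
  · exact hY.2.2 a X hXl hb
  refine (mem_level_last hn).2 ⟨triangular_saturated.comm_mem a X hX.1 b hb Y hY.1, ?_⟩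
  have hba : (b : ℕ) < a := hX.1 b hb
  have han := a.2
  by_cases hsub : X.erase b ⊆ Y
  · rw [Finset.union_eq_right.2 hsub, hYt.2.1]
    omega
  exfalso
  obtain ⟨c, hc, hcY⟩ := Finset.not_subset.1 hsub
  have hmex : minExcludant (parts Y) ≤ c + 1 := by
    by_contra h
    exact hcY (succ_mem_parts.1 (mem_of_lt_minExcludant (by omega) (by omega)))
  have hYn := hYt.2.2.2
  have h1 := weight_erase hb
  have h2 := weight_erase hc
  have hXw := hXt.2.1
  -- The bound `n < b + 1 + mex Y ≤ (b + 1) + (c + 1)` leaves nothing of the weight `a + 2 ≤ n + 1`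
  -- for a third letter. A pair is then refinable, as `x = 1 + (x - 1)` for one of its parts.
  have hempty : (X.erase b).erase c = ∅ := by
    rw [Finset.eq_empty_iff_forall_notMem]
    intro d hd
    have := le_weight hd
    omega
  have hXe : X = {b, c} := by
    rw [← Finset.insert_erase hb, ← Finset.insert_erase hc, hempty]; rfl
  have hb3 := three_le_of_mem_topLayer hYt
  rw [hempty, weight_empty] at h2
  have hpX : ∀ i, i ∈ parts X ↔ i = b + 1 ∨ i = c + 1 := by
    intro i
    rw [mem_parts, hXe]
    simp [eq_comm]
  have hpair : ∀ x : ℕ, x ∈ parts X → 3 ≤ x → x - 1 ∉ parts X → False := by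
    intro x hx hx3 hx1
    refine hXt.2.2.1.2.2 ⟨x, hx, {1, x - 1}, ?_, ?_, ?_⟩
    · simp; omega
    · rw [Finset.disjoint_left]
      intro i hi hi'
      rw [Finset.mem_insert, Finset.mem_singleton] at hi
      rcases hi with rfl | rfl
      · rw [hpX] at hi'
        omega
      · exact hx1 hi'
    · rw [Finset.sum_pair (by omega)]
      omega
  by_cases hcb : (c : ℕ) + 1 = b
  · refine hpair b ((hpX _).2 (by omega)) hb3 fun h => ?_
    rw [hpX] at h
    omega
  · refine hpair (b + 1) ((hpX _).2 (by omega)) (by omega) fun h => ?_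
    rw [hpX] at h
    omega

end Levels

/-! ### The last layer of the chain and the bijection with partitions. -/

section Chain

variable {n : ℕ}

theorem mem_normalizer_inf_sylowTwo {S : Fin n → Set (Finset (Fin n))} (hS : Saturated S)
    {H : Subgroup (Equiv.Perm (Fin n → ZMod 2))} (hH : H = hS.group)
    {g : Equiv.Perm (Fin n → ZMod 2)} :
    g ∈ Subgroup.normalizer (H : Set (Equiv.Perm (Fin n → ZMod 2))) ⊓ sylowTwo n ↔
      g ∈ tableaux (normalizing S) := by
  rw [hH, Subgroup.mem_inf, mem_sylowTwo_iff, hS.mem_normalizer_iff]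

theorem mem_normalizerChain_iff {j : ℕ} (hj : j + 2 ≤ n) {g : Equiv.Perm (Fin n → ZMod 2)} :
    g ∈ normalizerChain n j ↔ g ∈ tableaux (level n j) := by
  induction j generalizing g with
  | zero =>
    rw [normalizerChain, mem_normalizer_inf_sylowTwo singleton_saturated translationSubgroup_eq,
      normalizing_translations]
  | succ j ih =>
    rw [normalizerChain, mem_normalizer_inf_sylowTwo (level_saturated (by omega))
      (Subgroup.ext fun g => ih (by omega)), normalizing_level (by omega)]

theorem mem_normalizerChain_last_iff (hn : 2 ≤ n) {g : Equiv.Perm (Fin n → ZMod 2)} :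
    g ∈ normalizerChain n (n - 1) ↔ g ∈ tableaux (normalizing (level n (n - 2))) := by
  obtain ⟨m, rfl⟩ : ∃ m, n = m + 2 := ⟨n - 2, by omega⟩
  rw [show m + 2 - 1 = m + 1 by omega, normalizerChain,
    mem_normalizer_inf_sylowTwo (level_saturated le_rfl)
      (Subgroup.ext fun g => mem_normalizerChain_iff le_rfl)]
  rfl

theorem rigid_mem_layer_iff (hn : 2 ≤ n) {k : Fin n} {X : Finset (Fin n)}
    (hX : X ∈ triangular k) :
    (rigid k X ∈ normalizerChain n (n - 1) ∧ rigid k X ∉ normalizerChain n (n - 2)) ↔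
      X ∈ topLayer n k := by
  rw [mem_normalizerChain_last_iff hn, mem_normalizerChain_iff (by omega), rigid_mem_tableaux hX,
    rigid_mem_tableaux hX, mem_normalizing_last hn]
  constructor
  · rintro ⟨h1, h2⟩
    exact h1.resolve_left h2
  · intro h
    exact ⟨Or.inr h, notMem_level_of_mem_topLayer hn h⟩

theorem positions_mem_triangular {X : Finset ℕ} {k : Fin n} (hX : X ⊆ Finset.Icc 1 (k : ℕ)) :
    positions n X ∈ triangular k := fun x hx => by
  have := Finset.mem_Icc.1 (hX (mem_positions.1 hx))
  rw [Fin.lt_def]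
  omega

theorem parts_positions_of_subset {X : Finset ℕ} {k : Fin n} (hX : X ⊆ Finset.Icc 1 (k : ℕ)) :
    parts (positions n X) = X := parts_positions fun x hx => by
  have := Finset.mem_Icc.1 (hX hx)
  omega

theorem positions_mem_topLayer_iff {X : Finset ℕ} {k : Fin n} (hX : X ⊆ Finset.Icc 1 (k : ℕ)) :
    positions n X ∈ topLayer n k ↔ ∑ x ∈ X, x = k + 2 ∧ IsUnrefinablePartition X ∧
      n < k + 1 + minExcludant X := by
  have h1 := parts_positions_of_subset hX
  have h2 : weight (positions n X) = ∑ x ∈ X, x := by rw [← sum_parts, h1]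
  change _ ∧ _ ∧ _ ∧ _ ↔ _
  rw [h1, h2]
  exact and_iff_right (positions_mem_triangular hX)

theorem punctured_mem_layer_iff (hn : 2 ≤ n) {a : ℕ} {X : Finset ℕ} (ha : 1 < a)
    (hX : X ⊆ Finset.Icc 1 (a - 1)) :
    (punctured n a X ∈ normalizerChain n (n - 1) ∧ punctured n a X ∉ normalizerChain n (n - 2)) ↔
      (∑ x ∈ X, x = a + 1 ∧ IsUnrefinablePartition X ∧ a ≤ n ∧ n < a + minExcludant X) := by
  have haX : a ∉ X := fun h => by
    have := Finset.mem_Icc.1 (hX h)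
    omega
  by_cases han : a ≤ n
  · obtain ⟨k, rfl⟩ : ∃ k : Fin n, (k : ℕ) + 1 = a := ⟨⟨a - 1, by omega⟩, by simp; omega⟩
    rw [Nat.add_sub_cancel] at hX
    rw [punctured_eq_rigid k haX, rigid_mem_layer_iff hn (positions_mem_triangular hX),
      positions_mem_topLayer_iff hX]
    simp [han]
  -- For `a > n` the commutator is trivial, hence in `N_n^{n-2}`, and both sides fail.
  · rw [punctured_eq_one (by omega) haX]
    exact ⟨fun h => absurd (one_mem _) h.2, fun h => absurd h.2.2.1 han⟩

theorem exists_index {X : Finset ℕ} (hX : X ∈ mexPartitions n) :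
    ∃ k : Fin n, ∑ x ∈ X, x = k + 2 ∧ X ⊆ Finset.Icc 1 (k : ℕ) ∧ positions n X ∈ topLayer n k := by
  obtain ⟨hu, a, hs, hlt, han, hna⟩ := hX
  obtain ⟨x, hx⟩ := hu.1
  have hxa := hlt x hx
  have hk : a - 1 + 1 = a := by omega
  have hXI : X ⊆ Finset.Icc 1 (a - 1) := fun y hy => by
    have h1 : y ≠ 0 := fun e => hu.2.1 (e ▸ hy)
    have h2 := hlt y hy
    rw [Finset.mem_Icc]
    omega
  refine ⟨⟨a - 1, by omega⟩, by simp only; omega, hXI, (positions_mem_topLayer_iff hXI).2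
    ⟨by simp only; omega, hu, by simp only; omega⟩⟩

theorem parts_mem_mexPartitions {X : Finset (Fin n)} {k : Fin n} (hX : X ∈ topLayer n k) :
    parts X ∈ mexPartitions n := by
  refine ⟨hX.2.2.1, k + 1, by rw [sum_parts, hX.2.1], fun x hx => ?_, k.2, hX.2.2.2⟩
  obtain ⟨j, hj, rfl⟩ := mem_parts.1 hx
  have : (j : ℕ) < k := hX.1 j hj
  omega

theorem punctured_eq_of_index {X : Finset ℕ} {k : Fin n} (hs : ∑ x ∈ X, x = k + 2)
    (hX : X ⊆ Finset.Icc 1 (k : ℕ)) :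
    punctured n ((∑ x ∈ X, x) - 1) X = rigid k (positions n X) := by
  rw [hs, show (k : ℕ) + 2 - 1 = k + 1 by omega, punctured_eq_rigid]
  intro h
  have := Finset.mem_Icc.1 (hX h)
  omega

theorem rigid_injective {k l : Fin n} {X Y : Finset (Fin n)} (hX : X ∈ triangular k)
    (hY : Y ∈ triangular l) (h : rigid k X = rigid l Y) : k = l ∧ X = Y := by
  have hc : coeff X (disp (rigid l Y) k) = 1 := by
    rw [← h, disp_rigid_self hX, coeff_mono, if_pos rfl]
  by_cases hkl : k = l
  · subst hkl
    rw [disp_rigid_self hY, coeff_mono] at hc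
    exact ⟨rfl, by_contra fun hne => by simp [hne] at hc⟩
  · rw [disp_rigid_of_ne _ hkl, map_zero] at hc
    exact absurd hc zero_ne_one

theorem bijOn_mexPartitions (hn : 2 ≤ n) :
    Set.BijOn (fun X : Finset ℕ => punctured n ((∑ x ∈ X, x) - 1) X) (mexPartitions n)
      {g | g ∈ rigidCommutators n ∧ g ∈ normalizerChain n (n - 1) ∧
        g ∉ normalizerChain n (n - 2)} := by
  refine ⟨fun X hX => ?_, fun X hX Y hY h => ?_, ?_⟩
  · obtain ⟨k, hs, hXI, ht⟩ := exists_index hX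
    change punctured n ((∑ x ∈ X, x) - 1) X ∈ _
    rw [punctured_eq_of_index hs hXI]
    exact ⟨mem_rigidCommutators_iff.2 (Or.inr ⟨k, _, ht.1, rfl⟩), (rigid_mem_layer_iff hn ht.1).2 ht⟩
  · obtain ⟨k, hs, hXI, ht⟩ := exists_index hX
    obtain ⟨l, hs', hYI, ht'⟩ := exists_index hY
    change punctured n ((∑ x ∈ X, x) - 1) X = punctured n ((∑ x ∈ Y, x) - 1) Y at h
    rw [punctured_eq_of_index hs hXI, punctured_eq_of_index hs' hYI] at h
    have := (rigid_injective ht.1 ht'.1 h).2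
    rw [← parts_positions_of_subset hXI, this, parts_positions_of_subset hYI]
  · rintro g ⟨hg, h1, h2⟩
    rcases mem_rigidCommutators_iff.1 hg with rfl | ⟨k, X, hX, rfl⟩
    · exact absurd (one_mem _) h2
    · have ht := (rigid_mem_layer_iff hn hX).1 ⟨h1, h2⟩
      refine ⟨parts X, parts_mem_mexPartitions ht, ?_⟩
      change punctured n ((∑ x ∈ parts X, x) - 1) (parts X) = _
      rw [rigid_eq_punctured hX, sum_parts, ht.2.1]
      rfl

end Chain

/-! ### Exponents modulo `N_n^{n-2}` and the transversal. -/

section Transversal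

variable {n : ℕ}

/-- The exponent of the rigid commutator attached to the partition `X` in a permutation of the
last normalizer. -/
def exponent (X : Finset ℕ) (g : Equiv.Perm (Fin n → ZMod 2)) : ZMod 2 :=
  if h : (∑ x ∈ X, x) - 2 < n then coeff (positions n X) (disp g ⟨(∑ x ∈ X, x) - 2, h⟩) else 0

theorem exponent_eq {X : Finset ℕ} {k : Fin n} (hs : ∑ x ∈ X, x = k + 2)
    (g : Equiv.Perm (Fin n → ZMod 2)) :
    exponent X g = coeff (positions n X) (disp g k) := by
  have h : (∑ x ∈ X, x) - 2 = k := by omega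
  rw [exponent, dif_pos (by rw [h]; exact k.2)]
  congr 2
  exact Fin.ext h

/-- Precomposing `disp g k` with `h` changes it only by monomials of `N_n^{n-2}`, by
`comm_normalizing_last`, so the top coefficients add. -/
theorem exponent_mul (hn : 2 ≤ n) {X : Finset ℕ} (hX : X ∈ mexPartitions n)
    {g h : Equiv.Perm (Fin n → ZMod 2)} (hg : g ∈ normalizerChain n (n - 1))
    (hh : h ∈ normalizerChain n (n - 1)) : exponent X (g * h) = exponent X g + exponent X h := by
  obtain ⟨k, hs, -, ht⟩ := exists_index hX
  rw [mem_normalizerChain_last_iff hn] at hg hh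
  rw [exponent_eq hs, exponent_eq hs, exponent_eq hs, disp_mul, map_add]
  congr 1
  have hmem : disp g k ∘ h + disp g k ∈ mspan (level n (n - 2) k) :=
    comp_add_mem_mspan hh (fun b Y hY => hY.1)
      (fun X hX b hb Y hY => (mem_normalizing_last hn).2 (Or.inl (comm_normalizing_last hn hX hb hY)))
      (fun X hX b hb Y hY => comm_normalizing_last hn hX hb hY) (hg k)
  have hzero : coeff (positions n X) (disp g k ∘ h + disp g k) = 0 := by
    by_contra hne
    exact notMem_level_of_mem_topLayer hn ht (mem_of_coeff_ne_zero hmem hne)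
  rw [map_add] at hzero
  linear_combination hzero - zmod_two_add_self (coeff (positions n X) (disp g k))

theorem exponent_one (X : Finset ℕ) : exponent X (1 : Equiv.Perm (Fin n → ZMod 2)) = 0 := by
  rw [exponent]
  split_ifs
  · rw [disp_one, map_zero]
  · rfl

theorem exponent_inv (hn : 2 ≤ n) {X : Finset ℕ} (hX : X ∈ mexPartitions n)
    {g : Equiv.Perm (Fin n → ZMod 2)} (hg : g ∈ normalizerChain n (n - 1)) :
    exponent X g⁻¹ = exponent X g := by
  have h := exponent_mul hn hX hg (inv_mem hg)
  rw [mul_inv_cancel, exponent_one] at h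
  linear_combination h + zmod_two_add_self (exponent X g⁻¹)

theorem exponent_punctured {X Y : Finset ℕ} (hX : X ∈ mexPartitions n)
    (hY : Y ∈ mexPartitions n) :
    exponent X (punctured n ((∑ x ∈ Y, x) - 1) Y) = if X = Y then 1 else 0 := by
  obtain ⟨k, hs, hXI, -⟩ := exists_index hX
  obtain ⟨l, hs', hYI, ht'⟩ := exists_index hY
  rw [exponent_eq hs, punctured_eq_of_index hs' hYI]
  by_cases hXY : X = Y
  · subst hXY
    obtain rfl : k = l := Fin.ext (by omega)
    rw [if_pos rfl, disp_rigid_self ht'.1, coeff_mono, if_pos rfl]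
  · rw [if_neg hXY]
    by_cases hkl : k = l
    · subst hkl
      rw [disp_rigid_self ht'.1, coeff_mono, if_neg]
      intro e
      exact hXY (by rw [← parts_positions_of_subset hXI, e, parts_positions_of_subset hYI])
    · rw [disp_rigid_of_ne _ hkl, map_zero]

theorem mem_normalizerChain_iff_exponent (hn : 2 ≤ n) {g : Equiv.Perm (Fin n → ZMod 2)}
    (hg : g ∈ normalizerChain n (n - 1)) :
    g ∈ normalizerChain n (n - 2) ↔ ∀ X ∈ mexPartitions n, exponent X g = 0 := by
  rw [mem_normalizerChain_iff (by omega)]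
  rw [mem_normalizerChain_last_iff hn] at hg
  constructor
  · intro h X hX
    obtain ⟨k, hs, -, ht⟩ := exists_index hX
    rw [exponent_eq hs]
    by_contra hne
    exact notMem_level_of_mem_topLayer hn ht (mem_of_coeff_ne_zero (h k) hne)
  · intro h k
    refine mem_mspan_iff.2 fun X hX => ?_
    rcases (mem_normalizing_last hn).1 (mem_of_coeff_ne_zero (hg k) hX) with h1 | h1
    · exact h1
    · have h2 := h _ (parts_mem_mexPartitions h1)
      rw [exponent_eq (k := k) (by rw [sum_parts, h1.2.1]), positions_parts] at h2
      exact absurd h2 hX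

theorem list_prod_mem_and_exponent (hn : 2 ≤ n) {M : List (Finset ℕ)} (hM : M.Nodup)
    (hmex : ∀ Y ∈ M, Y ∈ mexPartitions n) :
    (M.map fun X => punctured n ((∑ x ∈ X, x) - 1) X).prod ∈ normalizerChain n (n - 1) ∧
      ∀ X ∈ mexPartitions n,
        exponent X (M.map fun X => punctured n ((∑ x ∈ X, x) - 1) X).prod
          = if X ∈ M then 1 else 0 := by
  induction M with
  | nil => exact ⟨one_mem _, fun X _ => by simpa using exponent_one X⟩
  | cons Y M ih =>
    obtain ⟨hYM, hM⟩ := List.nodup_cons.1 hM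
    obtain ⟨hY, hmex⟩ := List.forall_mem_cons.1 hmex
    obtain ⟨h1, h2⟩ := ih hM hmex
    have hc : punctured n ((∑ x ∈ Y, x) - 1) Y ∈ normalizerChain n (n - 1) :=
      ((bijOn_mexPartitions hn).mapsTo hY).2.1
    rw [List.map_cons, List.prod_cons]
    refine ⟨mul_mem hc h1, fun X hX => ?_⟩
    rw [exponent_mul hn hX hc h1, exponent_punctured hX hY, h2 X hX]
    by_cases hXY : X = Y
    · subst hXY
      simp [hYM]
    · simp [hXY]

theorem eq_filter_of_sublist {α : Type*} {M L : List α} (h : M.Sublist L) (hL : L.Nodup)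
    {p : α → Bool} (hp : ∀ x ∈ L, (x ∈ M ↔ p x = true)) : M = L.filter p := by
  induction h with
  | slnil => rfl
  | cons a h ih =>
    obtain ⟨haL, hL⟩ := List.nodup_cons.1 hL
    obtain ⟨ha, hp⟩ := List.forall_mem_cons.1 hp
    rw [List.filter_cons_of_neg (fun e => haL (h.subset (ha.2 e))), ← ih hL hp]
  | cons_cons a h ih =>
    obtain ⟨haL, hL⟩ := List.nodup_cons.1 hL
    obtain ⟨ha, hp⟩ := List.forall_mem_cons.1 hp
    rw [List.filter_cons_of_pos (ha.1 List.mem_cons_self), ← ih hL fun x hx => ?_]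
    rw [← hp x hx, List.mem_cons, or_iff_right fun e : x = a => haL (e ▸ hx)]

theorem existsUnique_sublist (hn : 2 ≤ n) {L : List (Finset ℕ)} (hL : L.Nodup)
    (hLm : ∀ X, X ∈ L ↔ X ∈ mexPartitions n) {g : Equiv.Perm (Fin n → ZMod 2)}
    (hg : g ∈ normalizerChain n (n - 1)) :
    ∃! M : List (Finset ℕ), M.Sublist L ∧
      g⁻¹ * (M.map (fun X => punctured n ((∑ x ∈ X, x) - 1) X)).prod ∈
        normalizerChain n (n - 2) := by
  -- The exponents of a product record which factors occur, whatever their order, so the coset of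
  -- `g` prescribes the members of `M`.
  have key : ∀ M : List (Finset ℕ), M.Sublist L →
      (g⁻¹ * (M.map (fun X => punctured n ((∑ x ∈ X, x) - 1) X)).prod ∈
        normalizerChain n (n - 2) ↔ ∀ X ∈ L, (X ∈ M ↔ exponent X g = 1)) := by
    intro M hML
    obtain ⟨h1, h2⟩ := list_prod_mem_and_exponent hn (hL.sublist hML)
      fun Y hY => (hLm Y).1 (hML.subset hY)
    rw [mem_normalizerChain_iff_exponent hn (mul_mem (inv_mem hg) h1)]
    refine forall_congr' fun X => ?_
    rw [hLm]
    refine forall_congr' fun hX => ?_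
    rw [exponent_mul hn hX (inv_mem hg) h1, exponent_inv hn hX hg, h2 X hX]
    have h11 : (1 : ZMod 2) + 1 = 0 := by decide
    rcases zmod_two_cases (exponent X g) with h | h <;> by_cases hXM : X ∈ M <;> simp [h, hXM, h11]
  refine ⟨L.filter fun X => exponent X g = 1, ⟨List.filter_sublist, (key _ List.filter_sublist).2 ?_⟩, ?_⟩
  · intro X hX
    simp [hX]
  · rintro M ⟨hML, hM⟩
    have hM := (key M hML).1 hM
    exact eq_filter_of_sublist hML hL fun X hX => by simp [hM X hX]

end Transversal

end BinaryTree

theorem mainTheorem1 (n : ℕ) (hn : 2 ≤ n) :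
    (∀ (a : ℕ) (X : Finset ℕ), 1 < a → X ⊆ Finset.Icc 1 (a - 1) →
      ((punctured n a X ∈ normalizerChain n (n - 1) ∧
          punctured n a X ∉ normalizerChain n (n - 2)) ↔
        (∑ x ∈ X, x = a + 1 ∧ IsUnrefinablePartition X ∧ a ≤ n ∧ n < a + minExcludant X))) ∧
    Set.BijOn (fun X : Finset ℕ => punctured n ((∑ x ∈ X, x) - 1) X) (mexPartitions n)
      {g | g ∈ rigidCommutators n ∧ g ∈ normalizerChain n (n - 1) ∧
        g ∉ normalizerChain n (n - 2)} ∧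
    (∀ L : List (Finset ℕ), L.Nodup → (∀ X, X ∈ L ↔ X ∈ mexPartitions n) →
      ∀ g ∈ normalizerChain n (n - 1), ∃! M : List (Finset ℕ), M.Sublist L ∧
        g⁻¹ * (M.map (fun X => punctured n ((∑ x ∈ X, x) - 1) X)).prod ∈
          normalizerChain n (n - 2)) :=
  ⟨fun _ _ ha hX => BinaryTree.punctured_mem_layer_iff hn ha hX,
    BinaryTree.bijOn_mexPartitions hn,
    fun _ hL hLm _ hg => BinaryTree.existsUnique_sublist hn hL hLm hg⟩
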